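/- **Theorem (FTAP).** Let $(\Omega,\mathcal F,(\mathcal F_t)_{t=0,\dots,T},\mathbb P)$ be a filtered probability space with $T\in\mathbb N=\{0,1,2,\dots\}$ such that $\mathcal F$ is separable, in the sense that some countable subfamily of $\mathcal F$ is dense in $\mathcal F$ for the pseudometric $\mathbb P(A\,\triangle\,B)$ (this holds in particular if $\mathcal F$ is countably generated). Let $d,L,M,N\in\mathbb N$ and let: * $S=(S_t)_{t=0,\dots,T}$ be an adapted $\mathbb R^d$-valued process (stock prices); * $f=(f^1,\dots,f^L)$ and $g=(g^1,\dots,g^M)$ be real $\mathcal F_T$-measurable random variables (payoffs of European options), with prices $\bar f\in\mathbb R^L$ and $\bar g\in\mathbb R^M$ at time $0$; * $h^k=(h^k_t)_{t=0,\dots,T}$, $k=1,\dots,N$, be real adapted processes (payoffs of American options), with prices $\bar h\in\mathbb R^N$ at time $0$; where $g$ and $h$ are bounded. The options $f$ can be bought and sold at time $0$; $g$ and $h$ can only be bought. A *liquidating strategy* is a real adapted process $\eta=(\eta_t)_{t=0,\dots,T}$ with $\eta_t\ge 0$ for all $t$ and $\sum_{t=0}^T\eta_t=1$ $\mathbb P$-a.s.;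 let $\mathbb T$ be the set of these, and for a real adapted process $\phi=(\phi_t)_{t=0,\dots,T}$ put $\eta(\phi)=\sum_{t=0}^T\phi_t\eta_t$. A *semi-static strategy* is a tuple $(H,a,b,c,\mu)$ with $H$ an adapted $\mathbb R^d$-valued process, $a\in\mathbb R^L$, $b\in\mathbb R_+^M$, $c\in\mathbb R_+^N$ and $\mu\in\mathbb T^N$. For $p\in\mathbb R^M$ and $q\in\mathbb R^N$ put $$\Phi_{p,q}(H,a,b,c,\mu)=\sum_{t=0}^{T-1}H_t\cdot(S_{t+1}-S_t)+\sum_{i=1}^L a^i(f^i-\bar f^i)+\sum_{j=1}^M b^j(g^j-p^j)+\sum_{k=1}^N c^k\big(\mu^k(h^k)-q^k\big).$$ *No arbitrage* (NA) holds with respect to $p,q$ if, for every semi-static strategy, $\Phi_{p,q}(H,a,b,c,\mu)\ge0$ $\mathbb P$-a.s. implies $\Phi_{p,q}(H,a,b,c,\mu)=0$ $\mathbb P$-a.s. *Strict no arbitrage* (SNA) holds if there are $\varepsilon_g\in(0,\infty)^M$ and $\varepsilon_h\in(0,\infty)^N$ such that NA holds with respect to $\bar g-\varepsilon_g$, $\bar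 h-\varepsilon_h$. Let $\mathcal Q$ be the set of probability measures $\mathbb Q$ on $\mathcal F$ which are equivalent to $\mathbb P$, under which $S$ is an $(\mathcal F_t)$-martingale, and which satisfy: each $f^i$ is $\mathbb Q$-integrable with $\mathbb E_{\mathbb Q}f^i=\bar f^i$; $\mathbb E_{\mathbb Q}g^j<\bar g^j$ for each $j$; and $\sup_{\tau}\mathbb E_{\mathbb Q}h^k_\tau<\bar h^k$ for each $k$, where the supremum is over all $(\mathcal F_t)$-stopping times $\tau$ with values in $\{0,\dots,T\}$. Then $$\text{SNA holds}\iff\mathcal Q\neq\emptyset.$$ -/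

import Mathlib

open MeasureTheory ProbabilityTheory
open scoped BigOperators

noncomputable section

namespace SemiStatic

/-- A discrete-time market on a filtered measurable space with times `0, …, T`: `d` stocks traded
dynamically, `L` European options which can be bought and sold at time `0`, `M` European options
which can only be bought, and `N` American options which can only be bought. -/
structure Market {Ω : Type*} {mΩ : MeasurableSpace Ω} {T : ℕ}
    (ℱ : Filtration (Fin (T + 1)) mΩ) (d L M N : ℕ) where
  /-- The stock price process. -/
  S : Fin (T + 1) → Ω → EuclideanSpace ℝ (Fin d)
  /-- Payoffs of the European options which can be bought and sold. -/
  f : Fin L → Ω → ℝ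
  /-- Prices of the options `f`. -/
  fbar : Fin L → ℝ
  /-- Payoffs of the European options which can only be bought. -/
  g : Fin M → Ω → ℝ
  /-- Prices of the options `g`. -/
  gbar : Fin M → ℝ
  /-- Payoff processes of the American options, which can only be bought. -/
  h : Fin N → Fin (T + 1) → Ω → ℝ
  /-- Prices of the options `h`. -/
  hbar : Fin N → ℝ
  adapted_S : Adapted ℱ S
  measurable_f : ∀ i, Measurable[ℱ (Fin.last T)] (f i)
  measurable_g : ∀ j, Measurable[ℱ (Fin.last T)] (g j)
  adapted_h : ∀ k, Adapted ℱ (h k)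
  bounded_g : ∃ C : ℝ, ∀ j ω, |g j ω| ≤ C
  bounded_h : ∃ C : ℝ, ∀ k t ω, |h k t ω| ≤ C

variable {Ω : Type*} {mΩ : MeasurableSpace Ω} {T : ℕ}

/-- A liquidating strategy: the fraction `η t` of one divisible unit of an American option is
exercised at time `t`. -/
structure IsLiquidating (ℱ : Filtration (Fin (T + 1)) mΩ) (P : Measure Ω)
    (η : Fin (T + 1) → Ω → ℝ) : Prop where
  adapted : Adapted ℱ η
  nonneg : ∀ t ω, 0 ≤ η t ω
  sum_eq_one : ∀ᵐ ω ∂P, ∑ t, η t ω = 1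

/-- The payoff `η(h) = ∑ₜ hₜ ηₜ` of an American option liquidated according to `η`. -/
def liquidationPayoff (η h : Fin (T + 1) → Ω → ℝ) (ω : Ω) : ℝ :=
  ∑ t, h t ω * η t ω

/-- The terminal gain `(H · S)_T = ∑_{t=0}^{T-1} Hₜ (Sₜ₊₁ - Sₜ)` of dynamic trading. -/
def tradingGain {d : ℕ} (H S : Fin (T + 1) → Ω → EuclideanSpace ℝ (Fin d)) (ω : Ω) : ℝ :=
  ∑ t : Fin T, inner ℝ (H t.castSucc ω) (S t.succ ω - S t.castSucc ω)

/-- Semi-static trading strategies `(H, a, b, c, μ)`. The measure `P` enters only through the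
almost sure equality in the definition of liquidating strategies. -/
structure Strategy (ℱ : Filtration (Fin (T + 1)) mΩ) (P : Measure Ω) (d L M N : ℕ) where
  H : Fin (T + 1) → Ω → EuclideanSpace ℝ (Fin d)
  a : Fin L → ℝ
  b : Fin M → ℝ
  c : Fin N → ℝ
  μ : Fin N → Fin (T + 1) → Ω → ℝ
  adapted_H : Adapted ℱ H
  b_nonneg : ∀ j, 0 ≤ b j
  c_nonneg : ∀ k, 0 ≤ c k
  liquidating : ∀ k, IsLiquidating ℱ P (μ k)

namespace Market

variable {ℱ : Filtration (Fin (T + 1)) mΩ} {d L M N : ℕ}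

/-- The terminal value of a semi-static strategy with initial wealth `0`, when the options `g` and
`h` are bought at prices `gp` and `hp` (and the options `f` are traded at their prices `fbar`). -/
def terminalValue (X : Market ℱ d L M N) {P : Measure Ω} (gp : Fin M → ℝ) (hp : Fin N → ℝ)
    (s : Strategy ℱ P d L M N) (ω : Ω) : ℝ :=
  tradingGain s.H X.S ω
    + ∑ i, s.a i * (X.f i ω - X.fbar i)
    + ∑ j, s.b j * (X.g j ω - gp j)
    + ∑ k, s.c k * (liquidationPayoff (s.μ k) (X.h k) ω - hp k)

/-- No arbitrage with respect to the prices `gp` of `g` and `hp` of `h`. -/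
def NoArbitrage (X : Market ℱ d L M N) (P : Measure Ω) (gp : Fin M → ℝ) (hp : Fin N → ℝ) : Prop :=
  ∀ s : Strategy ℱ P d L M N,
    (∀ᵐ ω ∂P, 0 ≤ X.terminalValue gp hp s ω) → ∀ᵐ ω ∂P, X.terminalValue gp hp s ω = 0

/-- Strict no arbitrage: no arbitrage persists after strictly lowering all prices of the options
`g` and `h`. -/
def StrictNoArbitrage (X : Market ℱ d L M N) (P : Measure Ω) : Prop :=
  ∃ (εg : Fin M → ℝ) (εh : Fin N → ℝ), (∀ j, 0 < εg j) ∧ (∀ k, 0 < εh k) ∧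
    X.NoArbitrage P (fun j => X.gbar j - εg j) (fun k => X.hbar k - εh k)

/-- `Q` is an equivalent martingale measure: a probability measure on the whole σ-algebra with the
same null sets as `P`, under which the stock price process is a martingale. -/
structure IsEMM (X : Market ℱ d L M N) (P Q : Measure Ω) : Prop where
  isProbabilityMeasure : IsProbabilityMeasure Q
  ac : Q ≪ P
  ac' : P ≪ Q
  martingale : Martingale X.S ℱ Q

/-- The value `sup_τ E_Q[h_τ]`, over all stopping times `τ` with values in `{0, …, T}`, of an
American option. For bounded adapted `h` and a probability measure `Q` this is the supremum of a
nonempty bounded set of expectations of bounded random variables. -/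
def americanValue (ℱ : Filtration (Fin (T + 1)) mΩ) (Q : Measure Ω)
    (h : Fin (T + 1) → Ω → ℝ) : ℝ :=
  ⨆ τ : {τ : Ω → Fin (T + 1) //
      IsStoppingTime ℱ (fun ω => ((τ ω : Fin (T + 1)) : WithTop (Fin (T + 1))))},
    ∫ ω, h (τ.1 ω) ω ∂Q

/-- The equivalent martingale measures `Q` with `E_Q f = fbar`, `E_Q g < gbar` and
`sup_τ E_Q h_τ < hbar`, componentwise. -/
def pricingMeasures (X : Market ℱ d L M N) (P : Measure Ω) : Set (Measure Ω) :=
  {Q | X.IsEMM P Q ∧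
    (∀ i, Integrable (X.f i) Q ∧ ∫ ω, X.f i ω ∂Q = X.fbar i) ∧
    (∀ j, ∫ ω, X.g j ω ∂Q < X.gbar j) ∧
    (∀ k, americanValue ℱ Q (X.h k) < X.hbar k)}

end Market

end SemiStatic

end

/-!
A measure `Q` in `pricingMeasures` excludes arbitrage at the prices given by its own values: a
liquidating strategy is a randomised stopping time (`integral_liquidationPayoff_le`), so that every
position in `f`, `g` and `h` has nonpositive expectation under `Q`, and trading in the martingale
`S` cannot turn such a claim into a nonzero nonnegative one, even if the gains are not integrable
(`tradingGain_add_eq_zero`).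

Conversely, assume strict no arbitrage. The gains from the stocks and from `f` form a linear space
`K`, built from one asset increment at a time. Without arbitrage in `K`, the claims dominated by
elements of `K` are closed under almost sure convergence (`isStableClosed_gains`): when an asset is
added, its positions either converge along a random subsequence, or explode, in which case the asset
was redundant (`IsStableClosed.sup_multiples`). Multiplied by a small weight, the square integrable
ones among these claims form a closed convex cone in `L²(P)`. Its polar contains a strictly positive
function `z₁`, because the polar is separable (`exists_polar_pos`).

The positions in `g` and `h` of total size one form a closed bounded convex subset of a Hilbert
space. In such sets, decreasing sequences of closed convex sets have common points, so that the sum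
of the cone and the payoffs of these positions is closed (`isClosed_add_image`). It does not contain
`0`, since otherwise the position would be an arbitrage at the lower prices
(`neg_positionPayoff_notMem`). Hence the pairing of some `z₀` in the polar with these payoffs is at
most a constant `-δ < 0`. For small `ε > 0`, the function `z₀ + ε z₁`, times the weight, is up to
normalisation the density of a measure in `pricingMeasures`: since this bound is uniform, the inequalities for `g` and for the supremum over stopping times of `h` are strict.
-/

namespace SemiStatic

open Filter Topology
open scoped ENNReal

/-! ### Measurable selection of a convergent subsequence -/

/-- A sequence of measurable real functions has, pointwise, a subsequence converging in `[-∞, ∞]`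
whose indices depend measurably on the point. The compactification is encoded by `arctan`, so that
the limits `± π / 2` stand for `± ∞`. -/
theorem exists_measurable_subseq_arctan {α : Type*} [MeasurableSpace α] (H : ℕ → α → ℝ)
    (hH : ∀ n, Measurable (H n)) :
    ∃ (σ : ℕ → α → ℕ) (y : α → ℝ), (∀ n, Measurable (σ n)) ∧ Measurable y ∧
      (∀ n x, n ≤ σ n x) ∧
      ∀ x, Tendsto (fun n => Real.arctan (H (σ n x) x)) atTop (𝓝 (y x)) := by
  classical
  have hu : ∀ n, Measurable fun x => Real.arctan (H n x) := fun n =>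
    Real.measurable_arctan.comp (hH n)
  set y : α → ℝ := fun x => limsup (fun n => Real.arctan (H n x)) atTop with hy
  have hym : Measurable y := Measurable.limsup hu
  have hbdd : ∀ x, IsBoundedUnder (· ≤ ·) atTop fun n => Real.arctan (H n x) := fun x =>
    isBoundedUnder_of ⟨Real.pi / 2, fun n => (Real.arctan_lt_pi_div_two _).le⟩
  have hbdd' : ∀ x, IsBoundedUnder (· ≥ ·) atTop fun n => Real.arctan (H n x) := fun x =>
    isBoundedUnder_of ⟨-(Real.pi / 2), fun n => (Real.neg_pi_div_two_lt_arctan _).le⟩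
  have hex : ∀ (n : ℕ) (x : α), ∃ m, n ≤ m ∧ |Real.arctan (H m x) - y x| < 1 / (n + 1 : ℝ) := by
    intro n x
    have hpos : (0 : ℝ) < 1 / (n + 1 : ℝ) := by positivity
    have h1 : ∃ᶠ m in atTop, y x - 1 / (n + 1 : ℝ) < Real.arctan (H m x) :=
      frequently_lt_of_lt_limsup (hbdd' x).isCoboundedUnder_le (by simp only [hy]; linarith)
    have h2 : ∀ᶠ m in atTop, Real.arctan (H m x) < y x + 1 / (n + 1 : ℝ) :=
      eventually_lt_of_limsup_lt (by simp only [hy]; linarith) (hbdd x)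
    obtain ⟨m, ⟨hm1, hm2⟩, hm3⟩ := ((h1.and_eventually h2).and_eventually
      (eventually_ge_atTop n)).exists
    exact ⟨m, hm3, abs_lt.2 ⟨by linarith, by linarith⟩⟩
  refine ⟨fun n x => Nat.find (hex n x), y, fun n => measurable_find (hex n) fun k => ?_, hym,
    fun n x => (Nat.find_spec (hex n x)).1, fun x => ?_⟩
  · by_cases hk : n ≤ k
    · simp only [hk, true_and]
      exact measurableSet_lt ((hu k).sub hym).abs measurable_const
    · simp [hk]
  · rw [tendsto_iff_dist_tendsto_zero]
    refine squeeze_zero (fun _ => dist_nonneg) (fun n => ?_)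
      (tendsto_one_div_add_atTop_nhds_zero_nat (𝕜 := ℝ))
    rw [Real.dist_eq]
    exact (Nat.find_spec (hex n x)).2.le

theorem measurable_eval_of_index {α : Type*} [MeasurableSpace α] {H : ℕ → α → ℝ}
    (hH : ∀ n, Measurable (H n)) {σ : α → ℕ} (hσ : Measurable σ) :
    Measurable fun x => H (σ x) x :=
  (measurable_from_prod_countable_right (f := fun p : ℕ × α => H p.1 p.2) hH).comp
    (hσ.prodMk measurable_id)

/-! ### Closedness of the set of superreplicable claims -/

section Closedness

variable {Ω : Type*} {mΩ : MeasurableSpace Ω}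

/-- The gains `H ξ` from holding a `𝒢`-measurable number `H` of units of an asset whose price
moves by `ξ`. -/
def multiples (𝒢 : MeasurableSpace Ω) (ξ : Ω → ℝ) : Submodule ℝ (Ω → ℝ) where
  carrier := {X | ∃ H : Ω → ℝ, Measurable[𝒢] H ∧ X = H * ξ}
  add_mem' := by
    rintro _ _ ⟨H, hH, rfl⟩ ⟨H', hH', rfl⟩
    exact ⟨H + H', hH.add hH', (add_mul _ _ _).symm⟩
  zero_mem' := ⟨0, measurable_const, (zero_mul _).symm⟩
  smul_mem' := by
    rintro c _ ⟨H, hH, rfl⟩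
    exact ⟨c • H, hH.const_smul c, (smul_mul_assoc _ _ _).symm⟩

/-- A space `K` of attainable gains is `𝒢`-stable and closed if it is a module over the
`𝒢`-measurable functions, allows to choose between countably many gains according to
`𝒢`-measurable information, and if the claims dominated by some gain in `K` form a set which is
closed under almost sure convergence. -/
structure IsStableClosed (P : Measure Ω) (𝒢 : MeasurableSpace Ω)
    (K : Submodule ℝ (Ω → ℝ)) : Prop where
  mul_mem : ∀ {H k : Ω → ℝ}, Measurable[𝒢] H → k ∈ K → H * k ∈ K
  glue_mem : ∀ {σ : Ω → ℕ} {k : ℕ → Ω → ℝ}, Measurable[𝒢] σ → (∀ n, k n ∈ K) →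
    (fun ω => k (σ ω) ω) ∈ K
  closed : ∀ {X : ℕ → Ω → ℝ} {Y : Ω → ℝ} {k : ℕ → Ω → ℝ}, (∀ n, k n ∈ K) →
    (∀ n, X n ≤ᵐ[P] k n) → (∀ᵐ ω ∂P, Tendsto (fun n => X n ω) atTop (𝓝 (Y ω))) →
    ∃ k ∈ K, Y ≤ᵐ[P] k

variable {P : Measure Ω} {𝒢 : MeasurableSpace Ω} {K : Submodule ℝ (Ω → ℝ)} {ξ : Ω → ℝ}

theorem IsStableClosed.bot (P : Measure Ω) (𝒢 : MeasurableSpace Ω) :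
    IsStableClosed P 𝒢 (⊥ : Submodule ℝ (Ω → ℝ)) where
  mul_mem := by
    intro H k _ hk
    rw [Submodule.mem_bot] at hk ⊢
    rw [hk, mul_zero]
  glue_mem := by
    intro σ k _ hk
    simp only [Submodule.mem_bot] at hk ⊢
    funext ω
    rw [hk]
  closed := by
    intro X Y k hk hX hY
    refine ⟨0, Submodule.zero_mem _, ?_⟩
    simp only [Submodule.mem_bot] at hk
    have hX' : ∀ᵐ ω ∂P, ∀ n, X n ω ≤ k n ω := ae_all_iff.2 hX
    filter_upwards [hX', hY] with ω h1 h2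
    exact le_of_tendsto' h2 fun n => by simpa [hk n] using h1 n

theorem IsStableClosed.mono {𝒢' : MeasurableSpace Ω} (hK : IsStableClosed P 𝒢 K) (h : 𝒢' ≤ 𝒢) :
    IsStableClosed P 𝒢' K where
  mul_mem := fun hH hk => hK.mul_mem (hH.mono h le_rfl) hk
  glue_mem := fun hσ hk => hK.glue_mem (hσ.mono h le_rfl) hk
  closed := hK.closed

/-- Where the positions explode, dividing by them shows in the limit that the asset itself is
redundant: by absence of arbitrage, its gain is already attainable in `K`. -/
theorem IsStableClosed.exists_eq_indicator (hK : IsStableClosed P 𝒢 K)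
    (hNA : ∀ k ∈ K, ∀ H : Ω → ℝ, Measurable[𝒢] H → 0 ≤ᵐ[P] k + H * ξ → k + H * ξ =ᵐ[P] 0)
    {E : Set Ω} (hE : MeasurableSet[𝒢] E) {X : ℕ → Ω → ℝ} {Y : Ω → ℝ} {k H : ℕ → Ω → ℝ}
    (hH : ∀ n, Measurable[𝒢] (H n)) (hk : ∀ n, k n ∈ K)
    (hX : ∀ n, X n ≤ᵐ[P] k n + H n * ξ)
    (hY : ∀ᵐ ω ∂P, Tendsto (fun n => X n ω) atTop (𝓝 (Y ω)))
    (hlim : ∀ ω ∈ E, Tendsto (fun n => H n ω) atTop atTop) :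
    ∃ k ∈ K, E.indicator ξ =ᵐ[P] k := by
  -- The absolute value keeps the factor nonnegative also for those `n` with `H n ω < 0`.
  set c : ℕ → Ω → ℝ := fun n => E.indicator fun ω => |H n ω|⁻¹ with hc
  have hcm : ∀ n, Measurable[𝒢] (c n) := fun n => (hH n).abs.inv.indicator hE
  have hc0 : ∀ n ω, 0 ≤ c n ω := fun n ω => Set.indicator_nonneg (fun _ _ => by positivity) ω
  obtain ⟨k₀, hk₀, hle⟩ := hK.closed (X := fun n => c n * (X n - H n * ξ))
    (Y := -E.indicator ξ) (k := fun n => c n * k n) (fun n => hK.mul_mem (hcm n) (hk n))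
    (fun n => by
      filter_upwards [hX n] with ω hω
      refine mul_le_mul_of_nonneg_left ?_ (hc0 n ω)
      simp only [Pi.add_apply, Pi.mul_apply, Pi.sub_apply] at hω ⊢
      linarith)
    (by
      filter_upwards [hY] with ω hω
      by_cases hωE : ω ∈ E
      · have hinf := hlim ω hωE
        have h1 : Tendsto (fun n => |H n ω|⁻¹ * X n ω - ξ ω) atTop (𝓝 (0 * Y ω - ξ ω)) :=
          (((tendsto_inv_atTop_zero.comp (tendsto_abs_atTop_atTop.comp hinf))).mul hω).sub_const _
        rw [zero_mul, zero_sub] at h1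
        simp only [Pi.neg_apply, Set.indicator_of_mem hωE]
        refine h1.congr' ?_
        filter_upwards [hinf.eventually_gt_atTop 0] with n hn
        simp only [hc, Pi.mul_apply, Pi.sub_apply, Set.indicator_of_mem hωE, abs_of_pos hn]
        field_simp
      · simp [hc, Set.indicator_of_notMem hωE])
  have hind : Measurable[𝒢] (E.indicator (1 : Ω → ℝ)) := measurable_const.indicator hE
  have heq : E.indicator (1 : Ω → ℝ) * ξ = E.indicator ξ := by
    funext ω
    by_cases hω : ω ∈ E <;> simp [hω]
  have h0 := hNA k₀ hk₀ _ hind (by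
    rw [heq]
    filter_upwards [hle] with ω hω
    simp only [Pi.neg_apply, Pi.zero_apply, Pi.add_apply] at hω ⊢
    linarith)
  rw [heq] at h0
  refine ⟨-k₀, K.neg_mem hk₀, ?_⟩
  filter_upwards [h0] with ω hω
  simp only [Pi.neg_apply, Pi.zero_apply, Pi.add_apply] at hω ⊢
  linarith

/-- Adding an asset preserves closedness. Along a `𝒢`-measurable subsequence the positions in the
new asset converge or explode; where they explode, the asset is redundant and its gains may be
moved into `K`. -/
theorem IsStableClosed.sup_multiples (hK : IsStableClosed P 𝒢 K)
    (hNA : ∀ k ∈ K ⊔ multiples 𝒢 ξ, 0 ≤ᵐ[P] k → k =ᵐ[P] 0) :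
    IsStableClosed P 𝒢 (K ⊔ multiples 𝒢 ξ) := by
  have hmem : ∀ {X : Ω → ℝ}, X ∈ K ⊔ multiples 𝒢 ξ ↔
      ∃ k ∈ K, ∃ H : Ω → ℝ, Measurable[𝒢] H ∧ X = k + H * ξ := by
    intro X
    rw [Submodule.mem_sup]
    constructor
    · rintro ⟨k, hk, _, ⟨H, hH, rfl⟩, rfl⟩
      exact ⟨k, hk, H, hH, rfl⟩
    · rintro ⟨k, hk, H, hH, rfl⟩
      exact ⟨k, hk, _, ⟨H, hH, rfl⟩, rfl⟩
  have hNA' : ∀ k ∈ K, ∀ H : Ω → ℝ, Measurable[𝒢] H → 0 ≤ᵐ[P] k + H * ξ →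
      k + H * ξ =ᵐ[P] 0 := fun k hk H hH => hNA _ (hmem.2 ⟨k, hk, H, hH, rfl⟩)
  refine ⟨?_, ?_, ?_⟩
  · intro F X hF hX
    obtain ⟨k, hk, H, hH, rfl⟩ := hmem.1 hX
    exact hmem.2 ⟨F * k, hK.mul_mem hF hk, F * H, hF.mul hH, by rw [mul_add, mul_assoc]⟩
  · intro σ X hσ hX
    choose k hk H hH hXe using fun n => hmem.1 (hX n)
    refine hmem.2 ⟨_, hK.glue_mem hσ hk, fun ω => H (σ ω) ω, ?_, ?_⟩
    · exact @measurable_eval_of_index Ω 𝒢 H hH σ hσ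
    · funext ω
      simp [hXe]
  · intro X Y k' hk' hX hY
    choose k hk H hH hke using fun n => hmem.1 (hk' n)
    obtain ⟨σ, y, hσ, hy, hσn, hlim⟩ := @exists_measurable_subseq_arctan Ω 𝒢 H hH
    set X₁ : ℕ → Ω → ℝ := fun n ω => X (σ n ω) ω
    set k₁ : ℕ → Ω → ℝ := fun n ω => k (σ n ω) ω
    set H₁ : ℕ → Ω → ℝ := fun n ω => H (σ n ω) ω with hH₁
    have hk₁ : ∀ n, k₁ n ∈ K := fun n => hK.glue_mem (hσ n) hk
    have hH₁m : ∀ n, Measurable[𝒢] (H₁ n) := fun n =>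
      @measurable_eval_of_index Ω 𝒢 H hH (σ n) (hσ n)
    have hX₁ : ∀ n, X₁ n ≤ᵐ[P] k₁ n + H₁ n * ξ := by
      intro n
      filter_upwards [ae_all_iff.2 hX] with ω hω
      have := hω (σ n ω)
      rw [hke] at this
      exact this
    have hY₁ : ∀ᵐ ω ∂P, Tendsto (fun n => X₁ n ω) atTop (𝓝 (Y ω)) := by
      filter_upwards [hY] with ω hω
      exact hω.comp (tendsto_atTop_mono (fun n => hσn n ω) tendsto_id)
    have htan : ∀ n ω, Real.tan (Real.arctan (H₁ n ω)) = H₁ n ω := fun n ω => Real.tan_arctan _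
    set E₁ : Set Ω := y ⁻¹' {Real.pi / 2}
    set E₂ : Set Ω := y ⁻¹' {-(Real.pi / 2)}
    have hE₁ : MeasurableSet[𝒢] E₁ := hy (measurableSet_singleton _)
    have hE₂ : MeasurableSet[𝒢] E₂ := hy (measurableSet_singleton _)
    obtain ⟨e₁, he₁, heq₁⟩ := hK.exists_eq_indicator hNA' hE₁ hH₁m hk₁ hX₁ hY₁ (by
      intro ω hω
      have h1 : Tendsto (fun n => Real.arctan (H₁ n ω)) atTop (𝓝[<] (Real.pi / 2)) := by
        refine tendsto_nhdsWithin_iff.2 ⟨?_, Eventually.of_forall fun n =>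
          Real.arctan_lt_pi_div_two _⟩
        have := hlim ω
        rwa [show y ω = Real.pi / 2 from hω] at this
      exact (Real.tendsto_tan_pi_div_two.comp h1).congr fun n => htan n ω)
    obtain ⟨e₂, he₂, heq₂⟩ := hK.exists_eq_indicator (ξ := -ξ) (H := fun n => -H₁ n)
      (fun k hk H hH => by
        have := hNA' k hk (-H) hH.neg
        rwa [neg_mul_comm] at this) hE₂ (fun n => (hH₁m n).neg) hk₁
      (fun n => by rw [neg_mul_neg]; exact hX₁ n) hY₁ (by
      intro ω hω
      have h1 : Tendsto (fun n => Real.arctan (H₁ n ω)) atTop (𝓝[>] (-(Real.pi / 2))) := by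
        refine tendsto_nhdsWithin_iff.2 ⟨?_, Eventually.of_forall fun n =>
          Real.neg_pi_div_two_lt_arctan _⟩
        have := hlim ω
        rwa [show y ω = -(Real.pi / 2) from hω] at this
      exact tendsto_neg_atBot_atTop.comp
        ((Real.tendsto_tan_neg_pi_div_two.comp h1).congr fun n => htan n ω))
    set L : Ω → ℝ := (E₁ ∪ E₂)ᶜ.indicator fun ω => Real.tan (y ω) with hL
    have htan_meas : Measurable Real.tan := by
      rw [funext Real.tan_eq_sin_div_cos]
      exact Real.measurable_sin.div Real.measurable_cos
    have hLm : Measurable[𝒢] L := (htan_meas.comp hy).indicator (hE₁.union hE₂).compl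
    -- The gains on `E₁ ∪ E₂` are moved into `K`, so that the remaining positions converge.
    obtain ⟨k₀, hk₀, hle⟩ := hK.closed
      (X := fun n => X₁ n - (E₁ ∪ E₂)ᶜ.indicator (H₁ n) * ξ) (Y := Y - L * ξ)
      (k := fun n => k₁ n + H₁ n * (e₁ - e₂))
      (fun n => K.add_mem (hk₁ n) (hK.mul_mem (hH₁m n) (K.sub_mem he₁ he₂)))
      (fun n => by
        filter_upwards [hX₁ n, heq₁, heq₂] with ω h1 h2 h3
        have h12 : ω ∈ E₁ → ω ∉ E₂ := fun h1 h2 => by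
          have h3 : y ω = Real.pi / 2 := h1
          have h4 : y ω = -(Real.pi / 2) := h2
          have := Real.pi_pos
          linarith
        simp only [Pi.add_apply, Pi.mul_apply, Pi.sub_apply, ← h2, ← h3] at h1 ⊢
        by_cases hω1 : ω ∈ E₁
        · simpa [hω1, h12 hω1] using h1
        · by_cases hω2 : ω ∈ E₂
          · simpa [hω1, hω2] using h1
          · simpa [hω1, hω2] using h1)
      (by
        filter_upwards [hY₁] with ω hω
        refine hω.sub (Tendsto.mul_const _ ?_)
        by_cases hωE : ω ∈ (E₁ ∪ E₂)ᶜ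
        · simp only [hL, Set.indicator_of_mem hωE]
          have hle : y ω ≤ Real.pi / 2 :=
            le_of_tendsto' (hlim ω) fun n => (Real.arctan_lt_pi_div_two _).le
          have hge : -(Real.pi / 2) ≤ y ω :=
            ge_of_tendsto' (hlim ω) fun n => (Real.neg_pi_div_two_lt_arctan _).le
          have hne1 : y ω ≠ Real.pi / 2 := fun h => hωE (Or.inl h)
          have hne2 : y ω ≠ -(Real.pi / 2) := fun h => hωE (Or.inr h)
          have hcos : Real.cos (y ω) ≠ 0 := (Real.cos_pos_of_mem_Ioo
            ⟨lt_of_le_of_ne hge hne2.symm, lt_of_le_of_ne hle hne1⟩).ne'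
          exact ((Real.continuousAt_tan.2 hcos).tendsto.comp (hlim ω)).congr fun n => htan n ω
        · simp only [hL, Set.indicator_of_notMem hωE]
          exact tendsto_const_nhds)
    refine ⟨k₀ + L * ξ, hmem.2 ⟨k₀, hk₀, L, hLm, rfl⟩, ?_⟩
    filter_upwards [hle] with ω hω
    simp only [Pi.add_apply, Pi.mul_apply, Pi.sub_apply] at hω ⊢
    linarith

/-- Adding finitely many assets traded on the same information preserves closedness. -/
theorem IsStableClosed.sup_finset_multiples {ι : Type*} (s : Finset ι) (ξ : ι → Ω → ℝ)
    (hK : IsStableClosed P 𝒢 K)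
    (hNA : ∀ k ∈ K ⊔ s.sup (fun i => multiples 𝒢 (ξ i)), 0 ≤ᵐ[P] k → k =ᵐ[P] 0) :
    IsStableClosed P 𝒢 (K ⊔ s.sup fun i => multiples 𝒢 (ξ i)) := by
  classical
  induction s using Finset.induction_on with
  | empty => simpa using hK
  | insert i s _ ih =>
    rw [Finset.sup_insert, sup_comm (multiples 𝒢 (ξ i)), ← sup_assoc] at hNA ⊢
    exact (ih fun k hk => hNA k (Submodule.mem_sup_left hk)).sup_multiples hNA

end Closedness

/-! ### Separation in Hilbert spaces -/

section Hilbert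

variable {E F : Type*} [NormedAddCommGroup E] [InnerProductSpace ℝ E] [CompleteSpace E]
  [NormedAddCommGroup F] [InnerProductSpace ℝ F]

/-- A decreasing sequence of nonempty closed bounded convex subsets of a Hilbert space has a common
point: the elements of minimal norm form a Cauchy sequence, by the parallelogram law. -/
theorem exists_forall_mem_of_antitone_convex {C : ℕ → Set E} (hanti : Antitone C)
    (hne : ∀ n, (C n).Nonempty) (hclosed : ∀ n, IsClosed (C n)) (hconv : ∀ n, Convex ℝ (C n))
    {R : ℝ} (hR : ∀ x ∈ C 0, ‖x‖ ≤ R) : ∃ x, ∀ n, x ∈ C n := by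
  have hmin : ∀ n, ∃ y ∈ C n, ∀ x ∈ C n, ‖y‖ ≤ ‖x‖ := by
    intro n
    obtain ⟨y, hy, hyn⟩ := exists_norm_eq_iInf_of_complete_convex (hne n)
      (hclosed n).isComplete (hconv n) 0
    refine ⟨y, hy, fun x hx => ?_⟩
    simp only [zero_sub, norm_neg] at hyn
    rw [hyn]
    exact ciInf_le ⟨0, by rintro _ ⟨w, rfl⟩; positivity⟩ (⟨x, hx⟩ : C n)
  choose y hy hymin using hmin
  have hmono : Monotone fun n => ‖y n‖ ^ 2 := fun n m hnm => by
    exact pow_le_pow_left₀ (norm_nonneg _) (hymin n (y m) (hanti hnm (hy m))) 2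
  have hbdd : BddAbove (Set.range fun n => ‖y n‖ ^ 2) := by
    refine ⟨R ^ 2, ?_⟩
    rintro _ ⟨n, rfl⟩
    have := hR _ (hanti (Nat.zero_le n) (hy n))
    dsimp only
    gcongr
  have hconvg := (tendsto_atTop_ciSup hmono hbdd).cauchySeq
  have hdist : ∀ n m, n ≤ m → ‖y n - y m‖ ^ 2 ≤ 2 * (‖y m‖ ^ 2 - ‖y n‖ ^ 2) := by
    intro n m hnm
    have hmid : (1 / 2 : ℝ) • y n + (1 / 2 : ℝ) • y m ∈ C n :=
      hconv n (hy n) (hanti hnm (hy m)) (by norm_num) (by norm_num) (by norm_num)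
    have h1 := hymin n _ hmid
    rw [← smul_add, norm_smul] at h1
    norm_num at h1
    have h2 := parallelogram_law_with_norm ℝ (y n) (y m)
    have h3 : (2 * ‖y n‖) ^ 2 ≤ ‖y n + y m‖ ^ 2 := by
      gcongr
      linarith
    nlinarith
  have hcauchy : CauchySeq y := by
    rw [Metric.cauchySeq_iff'] at hconvg ⊢
    intro ε hε
    obtain ⟨n, hn⟩ := hconvg (ε ^ 2 / 2) (by positivity)
    refine ⟨n, fun m hm => ?_⟩
    have h1 := hn m hm
    rw [Real.dist_eq] at h1
    have h2 := hdist n m hm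
    have h3 := le_abs_self (‖y m‖ ^ 2 - ‖y n‖ ^ 2)
    rw [dist_eq_norm, norm_sub_rev]
    exact lt_of_pow_lt_pow_left₀ 2 hε.le (by linarith)
  obtain ⟨x, hx⟩ := cauchySeq_tendsto_of_complete hcauchy
  refine ⟨x, fun n => (hclosed n).mem_of_tendsto hx ?_⟩
  filter_upwards [eventually_ge_atTop n] with m hm using hanti hm (hy m)

/-- The sum of a closed convex set and the image of a closed bounded convex set is closed. -/
theorem isClosed_add_image {A : Set F} (hA : IsClosed A) (hAconv : Convex ℝ A) {C : Set E}
    (hC : IsClosed C) (hCconv : Convex ℝ C) {R : ℝ} (hR : ∀ x ∈ C, ‖x‖ ≤ R) (Γ : E →L[ℝ] F) :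
    IsClosed {y | ∃ a ∈ A, ∃ x ∈ C, y = a + Γ x} := by
  refine isClosed_of_closure_subset fun y hy => ?_
  obtain ⟨x, hx⟩ := exists_forall_mem_of_antitone_convex
    (C := fun n : ℕ => C ∩ (fun x => y - Γ x) ⁻¹' Metric.cthickening (1 / (n + 1 : ℝ)) A)
    (fun n m hnm => Set.inter_subset_inter_right _ (Set.preimage_mono
      (Metric.cthickening_mono (one_div_le_one_div_of_le (by positivity) (by gcongr)) _)))
    (fun n => by
      obtain ⟨_, ⟨a, ha, x, hx, rfl⟩, hdist⟩ := Metric.mem_closure_iff.1 hy (1 / (n + 1 : ℝ))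
        (by positivity)
      refine ⟨x, hx, Metric.mem_cthickening_of_dist_le _ a _ _ ha ?_⟩
      rw [dist_eq_norm] at hdist ⊢
      rw [sub_sub, add_comm (Γ x)]
      exact hdist.le)
    (fun n => hC.inter (Metric.isClosed_cthickening.preimage
      (continuous_const.sub Γ.continuous)))
    (fun n => hCconv.inter (by
      intro u hu v hv s t hs ht hst
      have := hAconv.cthickening (1 / (n + 1 : ℝ)) hu hv hs ht hst
      simp only [Set.mem_preimage, map_add, map_smul] at this ⊢
      convert this using 1
      rw [smul_sub, smul_sub, sub_add_sub_comm, ← add_smul, hst, one_smul]))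
    (fun x hx => hR x hx.1)
  refine ⟨y - Γ x, ?_, x, (hx 0).1, by abel⟩
  rw [← hA.closure_eq, Metric.mem_closure_iff_infEDist_zero]
  have hle : ∀ n : ℕ, Metric.infEDist (y - Γ x) A ≤ ENNReal.ofReal (1 / (n + 1 : ℝ)) :=
    fun n => (hx n).2
  have hlim : Tendsto (fun n : ℕ => ENNReal.ofReal (1 / (n + 1 : ℝ))) atTop (𝓝 0) := by
    simpa using ENNReal.tendsto_ofReal (tendsto_one_div_add_atTop_nhds_zero_nat (𝕜 := ℝ))
  exact le_antisymm (ge_of_tendsto' hlim hle) zero_le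

/-- A closed convex cone `A` and the image of a closed bounded convex set `C`, such that no image of
a point of `C` has its opposite in `A`, are strictly separated by a vector of the polar of `A`. -/
theorem exists_polar_inner_le_neg [CompleteSpace F] {A : Set F} (hA : IsClosed A)
    (hAconv : Convex ℝ A) (hA0 : (0 : F) ∈ A) (hAsmul : ∀ a ∈ A, ∀ t : ℝ, 0 ≤ t → t • a ∈ A)
    {C : Set E} (hC : IsClosed C) (hCconv : Convex ℝ C) {R : ℝ} (hR : ∀ x ∈ C, ‖x‖ ≤ R)
    (Γ : E →L[ℝ] F) (hdisj : ∀ x ∈ C, -Γ x ∉ A) :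
    ∃ z : F, ∃ δ : ℝ, 0 < δ ∧ (∀ a ∈ A, inner ℝ z a ≤ 0) ∧ ∀ x ∈ C, inner ℝ z (Γ x) ≤ -δ := by
  rcases C.eq_empty_or_nonempty with rfl | ⟨x₀, hx₀⟩
  · exact ⟨0, 1, one_pos, by simp, by simp⟩
  have hconv : Convex ℝ {y | ∃ a ∈ A, ∃ x ∈ C, y = a + Γ x} := by
    rintro _ ⟨a, ha, x, hx, rfl⟩ _ ⟨b, hb, y, hy, rfl⟩ s t hs ht hst
    refine ⟨s • a + t • b, hAconv ha hb hs ht hst, s • x + t • y, hCconv hx hy hs ht hst, ?_⟩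
    simp only [map_add, map_smul, smul_add]
    abel
  obtain ⟨φ, u, hu, hu0⟩ := geometric_hahn_banach_closed_point hconv
    (isClosed_add_image hA hAconv hC hCconv hR Γ) (x := 0) (by
      rintro ⟨a, ha, x, hx, h0⟩
      exact hdisj x hx (by rwa [← eq_neg_of_add_eq_zero_left h0.symm]))
  rw [map_zero] at hu0
  refine ⟨(InnerProductSpace.toDual ℝ F).symm φ, -u, by linarith, fun a ha => ?_, fun x hx => ?_⟩
  · rw [InnerProductSpace.toDual_symm_apply]
    by_contra! hpos
    -- A positive value on `a` would be unbounded along the ray through `a`.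
    have h1 := hu _ ⟨_, hAsmul a ha ((|φ (Γ x₀)| + |u|) / φ a) (by positivity), x₀, hx₀, rfl⟩
    rw [map_add, map_smul, smul_eq_mul, div_mul_cancel₀ _ hpos.ne'] at h1
    have h2 := neg_abs_le (φ (Γ x₀))
    have h3 := le_abs_self u
    linarith
  · rw [InnerProductSpace.toDual_symm_apply, neg_neg]
    have := hu _ ⟨0, hA0, x, hx, rfl⟩
    rw [zero_add] at this
    exact this.le

/-- The polar of a closed convex cone in a separable Hilbert space contains a vector which is
strictly positive on every `x ∉ A` with `-x ∈ A`: a positive combination of a dense sequence of the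
polar. -/
theorem exists_polar_inner_pos [CompleteSpace F] [SecondCountableTopology F] {A : Set F}
    (hA : IsClosed A) (hAconv : Convex ℝ A) (hA0 : (0 : F) ∈ A)
    (hAsmul : ∀ a ∈ A, ∀ t : ℝ, 0 ≤ t → t • a ∈ A) :
    ∃ z : F, (∀ a ∈ A, inner ℝ z a ≤ 0) ∧ ∀ x, -x ∈ A → x ∉ A → 0 < inner ℝ z x := by
  set Z : Set F := {z | ∀ a ∈ A, inner ℝ z a ≤ 0}
  have : Nonempty Z := ⟨⟨0, fun a _ => by simp⟩⟩
  set z : ℕ → F := fun n => (TopologicalSpace.denseSeq Z n : F)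
  have hz : ∀ n, ∀ a ∈ A, inner ℝ (z n) a ≤ 0 := fun n => (TopologicalSpace.denseSeq Z n).2
  set c : ℕ → ℝ := fun n => (1 / 2) ^ n * (1 + ‖z n‖)⁻¹
  have hc : ∀ n, 0 < c n := fun n => by positivity
  have hsum : Summable fun n => c n • z n := by
    refine Summable.of_norm_bounded summable_geometric_two fun n => ?_
    rw [norm_smul, Real.norm_of_nonneg (hc n).le, mul_assoc]
    refine mul_le_of_le_one_right (by positivity) ?_
    rw [inv_mul_le_one₀ (by positivity)]
    linarith
  have hinner : ∀ x, HasSum (fun n => c n * inner ℝ (z n) x) (inner ℝ (∑' n, c n • z n) x) := by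
    intro x
    have := (innerSL ℝ x).hasSum hsum.hasSum
    simpa only [innerSL_apply_apply, real_inner_smul_left, fun a => real_inner_comm a x] using this
  refine ⟨∑' n, c n • z n, fun a ha => ?_, fun x hx hxA => ?_⟩
  · exact hasSum_le (fun n => mul_nonpos_of_nonneg_of_nonpos (hc n).le (hz n a ha)) (hinner a)
      hasSum_zero
  · obtain ⟨y, δ, hδ, hyA, hyx⟩ := exists_polar_inner_le_neg hA hAconv hA0 hAsmul
      (C := {-x}) isClosed_singleton (convex_singleton _) (R := ‖-x‖) (by simp)
      (ContinuousLinearMap.id ℝ F) (by simpa using hxA)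
    have hyx' : 0 < inner ℝ y x := by
      have := hyx (-x) rfl
      rw [ContinuousLinearMap.id_apply, inner_neg_right] at this
      linarith
    have hopen : IsOpen {w : Z | 0 < inner ℝ (w : F) x} :=
      isOpen_lt continuous_const (by fun_prop)
    obtain ⟨n, hn⟩ := (TopologicalSpace.denseRange_denseSeq Z).exists_mem_open hopen
      ⟨⟨y, hyA⟩, hyx'⟩
    have hnonneg : ∀ m, 0 ≤ c m * inner ℝ (z m) x := fun m => by
      have := hz m _ hx
      rw [inner_neg_right] at this
      exact mul_nonneg (hc m).le (by linarith)
    exact (mul_pos (hc n) hn).trans_le (le_hasSum (hinner x) n fun m _ => hnonneg m)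

end Hilbert

/-! ### Trading in a martingale -/

section Trading

variable {Ω : Type*} {mΩ : MeasurableSpace Ω} {Q : Measure Ω} {T d : ℕ}

/-- One trading period: if `V + ⟪H, ξ⟫ + G ≥ 0`, where `V` and `H` are known at the start and `ξ`
has conditional mean zero, then `V + E[G | m] ≥ 0`, and equality in the latter forces equality in
the former. The factor `(1 + |V| + ‖H‖)⁻¹` makes all terms integrable. -/
theorem condExp_trading_step [IsProbabilityMeasure Q] {m : MeasurableSpace Ω} (hm : m ≤ mΩ)
    {V G : Ω → ℝ} {H ξ : Ω → EuclideanSpace ℝ (Fin d)} (hV : Measurable[m] V)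
    (hH : Measurable[m] H) (hξ : Integrable ξ Q) (hξ0 : Q[ξ | m] =ᵐ[Q] 0) (hG : Integrable G Q)
    (hpos : ∀ᵐ ω ∂Q, 0 ≤ V ω + inner ℝ (H ω) (ξ ω) + G ω) :
    (∀ᵐ ω ∂Q, 0 ≤ V ω + (Q[G | m]) ω) ∧
      ((∀ᵐ ω ∂Q, V ω + (Q[G | m]) ω = 0) → ∀ᵐ ω ∂Q, V ω + inner ℝ (H ω) (ξ ω) + G ω = 0) := by
  set φ : Ω → ℝ := fun ω => (1 + |V ω| + ‖H ω‖)⁻¹ with hφ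
  have hφm : Measurable[m] φ := ((measurable_const.add hV.abs).add hH.norm).inv
  have hφ0 : ∀ ω, 0 < φ ω := fun ω => by positivity
  have hφV : ∀ ω, ‖φ ω * V ω‖ ≤ 1 := fun ω => by
    rw [norm_mul, Real.norm_of_nonneg (hφ0 ω).le, Real.norm_eq_abs, inv_mul_le_one₀ (by positivity)]
    linarith [norm_nonneg (H ω)]
  have hφH : ∀ ω, ‖φ ω • H ω‖ ≤ 1 := fun ω => by
    rw [norm_smul, Real.norm_of_nonneg (hφ0 ω).le, inv_mul_le_one₀ (by positivity)]
    linarith [abs_nonneg (V ω)]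
  have hφ1 : ∀ ω, ‖φ ω‖ ≤ 1 := fun ω => by
    rw [Real.norm_of_nonneg (hφ0 ω).le]
    exact inv_le_one_of_one_le₀ (by linarith [abs_nonneg (V ω), norm_nonneg (H ω)])
  have hφVm : StronglyMeasurable[m] fun ω => φ ω * V ω := (hφm.mul hV).stronglyMeasurable
  have hφHm : StronglyMeasurable[m] fun ω => φ ω • H ω := (hφm.smul hH).stronglyMeasurable
  have hi1 : Integrable (fun ω => φ ω * V ω) Q :=
    Integrable.of_bound (hφVm.mono hm).aestronglyMeasurable 1 (ae_of_all _ hφV)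
  have hi2 : Integrable (fun ω => inner ℝ (φ ω • H ω) (ξ ω)) Q := by
    refine hξ.norm.mono' ((hφHm.mono hm).aestronglyMeasurable.inner hξ.1) (ae_of_all _ fun ω => ?_)
    exact (norm_inner_le_norm _ _).trans (mul_le_of_le_one_left (norm_nonneg _) (hφH ω))
  have hi3 : Integrable (fun ω => φ ω * G ω) Q :=
    hG.bdd_mul (hφm.mono hm le_rfl).aestronglyMeasurable (ae_of_all _ hφ1)
  have hW : ∀ ω, φ ω * V ω + inner ℝ (φ ω • H ω) (ξ ω) + φ ω * G ω =
      φ ω * (V ω + inner ℝ (H ω) (ξ ω) + G ω) := fun ω => by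
    rw [real_inner_smul_left]; ring
  set W : Ω → ℝ := ((fun ω => φ ω * V ω) + fun ω => inner ℝ (φ ω • H ω) (ξ ω)) +
    fun ω => φ ω * G ω with hWdef
  have hWi : Integrable W Q := (hi1.add hi2).add hi3
  have hW0 : 0 ≤ᵐ[Q] W := by
    filter_upwards [hpos] with ω hω
    exact (mul_nonneg (hφ0 ω).le hω).trans_eq (hW ω).symm
  have hcond : Q[W | m] =ᵐ[Q] fun ω => φ ω * (V ω + (Q[G | m]) ω) := by
    have e2 : Q[fun ω => inner ℝ (φ ω • H ω) (ξ ω) | m] =ᵐ[Q]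
        fun ω => inner ℝ (φ ω • H ω) ((Q[ξ | m]) ω) :=
      condExp_stronglyMeasurable_bilin_of_bound (innerSL ℝ) hm hφHm hξ 1 (ae_of_all _ hφH)
    have e3 := condExp_stronglyMeasurable_mul_of_bound hm hφm.stronglyMeasurable hG 1
      (ae_of_all Q hφ1)
    have e1 : Q[fun ω => φ ω * V ω | m] = fun ω => φ ω * V ω :=
      condExp_of_stronglyMeasurable hm hφVm hi1
    filter_upwards [condExp_add (hi1.add hi2) hi3 m, condExp_add hi1 hi2 m, e2, e3, hξ0]
      with ω h1 h2 h3 h4 h5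
    rw [h1, Pi.add_apply, h2, Pi.add_apply, e1, h3, h5, Pi.zero_apply, inner_zero_right]
    rw [show (fun ω => φ ω * G ω) = φ * G from rfl, h4, Pi.mul_apply]
    ring
  refine ⟨?_, fun hzero => ?_⟩
  · filter_upwards [hcond, condExp_nonneg (m := m) hW0] with ω h1 h2
    rw [h1] at h2
    exact nonneg_of_mul_nonneg_right h2 (hφ0 ω)
  · have hint : ∫ ω, W ω ∂Q = 0 := by
      rw [← integral_condExp hm, integral_congr_ae hcond]
      refine integral_eq_zero_of_ae ?_
      filter_upwards [hzero] with ω hω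
      rw [hω, mul_zero]
      rfl
    filter_upwards [(integral_eq_zero_iff_of_nonneg_ae hW0 hWi).1 hint] with ω hω
    have : φ ω * (V ω + inner ℝ (H ω) (ξ ω) + G ω) = 0 := (hW ω).symm.trans hω
    exact (mul_eq_zero.1 this).resolve_left (hφ0 ω).ne'

theorem measurable_partial_gain {ℱ : Filtration (Fin (T + 1)) mΩ}
    {H S : Fin (T + 1) → Ω → EuclideanSpace ℝ (Fin d)} (hH : Adapted ℱ H) (hS : Adapted ℱ S)
    (t : Fin T) :
    Measurable[ℱ t.castSucc] fun ω => ∑ s ∈ Finset.Iio t,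
      inner ℝ (H s.castSucc ω) (S s.succ ω - S s.castSucc ω) := by
  refine Finset.measurable_sum _ fun s hs => ?_
  have hs' : s < t := Finset.mem_Iio.1 hs
  have h1 : s.castSucc ≤ t.castSucc := Fin.castSucc_le_castSucc_iff.2 hs'.le
  have h2 : s.succ ≤ t.castSucc := Fin.succ_le_castSucc_iff.2 hs'
  exact ((hH s.castSucc).mono (ℱ.mono h1) le_rfl).inner
    (((hS s.succ).mono (ℱ.mono h2) le_rfl).sub ((hS s.castSucc).mono (ℱ.mono h1) le_rfl))

/-- Trading in a martingale yields no arbitrage, even when it is combined with an integrable claim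
of nonpositive expectation. No integrability of the strategy is needed. -/
theorem tradingGain_add_eq_zero [IsProbabilityMeasure Q] {ℱ : Filtration (Fin (T + 1)) mΩ}
    {H S : Fin (T + 1) → Ω → EuclideanSpace ℝ (Fin d)} (hH : Adapted ℱ H) (hS : Martingale S ℱ Q)
    {G : Ω → ℝ} (hG : Integrable G Q) (hG0 : ∫ ω, G ω ∂Q ≤ 0)
    (hpos : ∀ᵐ ω ∂Q, 0 ≤ tradingGain H S ω + G ω) :
    ∀ᵐ ω ∂Q, tradingGain H S ω + G ω = 0 := by
  -- Induction on the number of trading periods: the last one is removed by conditioning on its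
  -- start, which replaces `G` by its conditional expectation.
  have key : ∀ n, n ≤ T → ∀ G : Ω → ℝ, Integrable G Q → ∫ ω, G ω ∂Q ≤ 0 →
      (∀ᵐ ω ∂Q, 0 ≤ (∑ s : Fin T with s.val < n,
        inner ℝ (H s.castSucc ω) (S s.succ ω - S s.castSucc ω)) + G ω) →
      ∀ᵐ ω ∂Q, (∑ s : Fin T with s.val < n,
        inner ℝ (H s.castSucc ω) (S s.succ ω - S s.castSucc ω)) + G ω = 0 := by
    intro n
    induction n with
    | zero =>
      intro _ G hG hG0 hpos
      simp only [not_lt_zero, Finset.filter_false, Finset.sum_empty, zero_add] at hpos ⊢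
      exact (integral_eq_zero_iff_of_nonneg_ae hpos hG).1
        (le_antisymm hG0 (integral_nonneg_of_ae hpos))
    | succ n ih =>
      intro hn G hG hG0 hpos
      set t : Fin T := ⟨n, hn⟩ with ht
      have hfil : (Finset.univ.filter fun s : Fin T => s.val < n) = Finset.Iio t := by
        ext s
        simp [ht, Fin.lt_def]
      have hfil' : (Finset.univ.filter fun s : Fin T => s.val < n + 1) =
          insert t (Finset.Iio t) := by
        ext s
        simp only [ht, Finset.mem_filter, Finset.mem_univ, true_and, Finset.mem_insert,
          Finset.mem_Iio, Fin.lt_def, Fin.ext_iff]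
        omega
      have hsum : ∀ ω, (∑ s : Fin T with s.val < n + 1,
          inner ℝ (H s.castSucc ω) (S s.succ ω - S s.castSucc ω)) =
          (∑ s ∈ Finset.Iio t, inner ℝ (H s.castSucc ω) (S s.succ ω - S s.castSucc ω)) +
            inner ℝ (H t.castSucc ω) (S t.succ ω - S t.castSucc ω) := fun ω => by
        rw [hfil', Finset.sum_insert (by simp), add_comm]
      simp only [hsum] at hpos ⊢
      simp only [hfil] at ih
      have hm := ℱ.le t.castSucc
      have hξ0 : Q[S t.succ - S t.castSucc | ℱ t.castSucc] =ᵐ[Q] 0 := by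
        filter_upwards [condExp_sub (hS.integrable t.succ) (hS.integrable t.castSucc)
          (ℱ t.castSucc), hS.condExp_ae_eq (Fin.castSucc_lt_succ (i := t)).le] with ω h1 h2
        rw [h1, Pi.sub_apply, h2, condExp_of_stronglyMeasurable hm (hS.1 _) (hS.integrable _),
          sub_self]
        rfl
      obtain ⟨h1, h2⟩ := condExp_trading_step hm
        (measurable_partial_gain hH (fun i => (hS.1 i).measurable) t) (hH t.castSucc)
        ((hS.integrable t.succ).sub (hS.integrable t.castSucc)) hξ0 hG hpos
      exact h2 (ih (by omega) _ integrable_condExp (by rwa [integral_condExp hm]) h1)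
  have hT := key T le_rfl G hG hG0
  simp only [Fin.is_lt, Finset.filter_true] at hT
  exact hT hpos

end Trading

/-! ### Liquidating strategies as randomised stopping times -/

section Randomisation

variable {Ω : Type*} {mΩ : MeasurableSpace Ω} {T : ℕ} {ℱ : Filtration (Fin (T + 1)) mΩ}
  {Q : Measure Ω} {η h : Fin (T + 1) → Ω → ℝ}

/-- The first time at which at least the fraction `u` of the option has been exercised, or the
terminal time if there is none. -/
noncomputable def exerciseTime (η : Fin (T + 1) → Ω → ℝ) (u : ℝ) (ω : Ω) : Fin (T + 1) :=
  (Finset.univ.filter fun t => u ≤ ∑ s ∈ Finset.Iic t, η s ω ∨ t = Fin.last T).min'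
    ⟨Fin.last T, by simp⟩

theorem exerciseTime_le_iff (h0 : ∀ t ω, 0 ≤ η t ω) {u : ℝ} {ω : Ω} {t : Fin (T + 1)} :
    exerciseTime η u ω ≤ t ↔ u ≤ ∑ s ∈ Finset.Iic t, η s ω ∨ t = Fin.last T := by
  constructor
  · intro hle
    have hmem := Finset.min'_mem (Finset.univ.filter fun t =>
      u ≤ ∑ s ∈ Finset.Iic t, η s ω ∨ t = Fin.last T) ⟨Fin.last T, by simp⟩
    rcases (Finset.mem_filter.1 hmem).2 with h1 | h1
    · refine Or.inl (h1.trans (Finset.sum_le_sum_of_subset_of_nonneg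
        (Finset.Iic_subset_Iic.2 hle) fun i _ _ => h0 i ω))
    · exact Or.inr (le_antisymm (Fin.le_last _) (h1.ge.trans hle))
  · intro h1
    exact Finset.min'_le _ _ (by simpa using h1)

theorem isStoppingTime_exerciseTime (hη : Adapted ℱ η) (h0 : ∀ t ω, 0 ≤ η t ω) (u : ℝ) :
    IsStoppingTime ℱ fun ω => ((exerciseTime η u ω : Fin (T + 1)) : WithTop (Fin (T + 1))) := by
  intro t
  simp only [WithTop.coe_le_coe, exerciseTime_le_iff h0]
  by_cases ht : t = Fin.last T
  · simp [ht]
  · simp only [ht, or_false]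
    refine measurableSet_le measurable_const (Finset.measurable_sum _ fun s hs => ?_)
    exact (hη s).mono (ℱ.mono (Finset.mem_Iic.1 hs)) le_rfl

theorem exerciseTime_eq_iff (h0 : ∀ t ω, 0 ≤ η t ω) {u : ℝ} (hu : u ∈ Set.Ioc (0 : ℝ) 1) {ω : Ω}
    (h1 : ∑ t, η t ω = 1) {t : Fin (T + 1)} :
    exerciseTime η u ω = t ↔
      u ∈ Set.Ioc (∑ s ∈ Finset.Iio t, η s ω) (∑ s ∈ Finset.Iic t, η s ω) := by
  have hle : ∀ t, exerciseTime η u ω ≤ t ↔ u ≤ ∑ s ∈ Finset.Iic t, η s ω := by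
    intro t
    rw [exerciseTime_le_iff h0]
    refine ⟨?_, Or.inl⟩
    rintro (h | rfl)
    · exact h
    · have : Finset.Iic (Fin.last T) = Finset.univ := by ext; simp [Fin.le_last]
      rw [this, h1]
      exact hu.2
  have hlt : exerciseTime η u ω < t ↔ u ≤ ∑ s ∈ Finset.Iio t, η s ω := by
    refine Fin.cases ?_ (fun i => ?_) t
    · have : Finset.Iio (0 : Fin (T + 1)) = ∅ := by ext; simp
      simpa [this] using hu.1
    · have : Finset.Iio i.succ = Finset.Iic i.castSucc := by
        ext s
        simp only [Finset.mem_Iio, Finset.mem_Iic, Fin.lt_def, Fin.le_def, Fin.val_succ,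
          Fin.val_castSucc]
        omega
      rw [this, ← hle, ← Fin.le_castSucc_iff]
  rw [Set.mem_Ioc, ← hle, ← not_le, ← hlt, not_lt, le_antisymm_iff, and_comm]

theorem bddAbove_integral_stopped [IsProbabilityMeasure Q] {C : ℝ} (hC : ∀ t ω, |h t ω| ≤ C) :
    BddAbove (Set.range fun τ : {τ : Ω → Fin (T + 1) //
      IsStoppingTime ℱ (fun ω => ((τ ω : Fin (T + 1)) : WithTop (Fin (T + 1))))} =>
      ∫ ω, h (τ.1 ω) ω ∂Q) := by
  refine ⟨C, ?_⟩
  rintro _ ⟨τ, rfl⟩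
  have := norm_integral_le_of_norm_le_const (μ := Q) 
    (f := fun ω => h (τ.1 ω) ω) (ae_of_all _ fun ω => hC (τ.1 ω) ω)
  rw [probReal_univ, mul_one] at this
  exact (le_abs_self _).trans this

/-- Liquidating an American option fractionally is worth at most as much as its best stopping time.
With `u` uniformly distributed on `(0, 1]`, the time at which the exercised fraction reaches `u` is
`t` with conditional probability `η t`. -/
theorem integral_liquidationPayoff_le [IsProbabilityMeasure Q] (hη : IsLiquidating ℱ Q η)
    (hh : Adapted ℱ h) {C : ℝ} (hC : ∀ t ω, |h t ω| ≤ C) :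
    ∫ ω, liquidationPayoff η h ω ∂Q ≤ Market.americanValue ℱ Q h := by
  have hηm : ∀ t, Measurable (η t) := fun t => (hη.adapted t).mono (ℱ.le t) le_rfl
  have hhm : ∀ t, Measurable (h t) := fun t => (hh t).mono (ℱ.le t) le_rfl
  set J : Fin (T + 1) → Set (Ω × ℝ) := fun t => {p | p.2 ∈
    Set.Ioc (∑ s ∈ Finset.Iio t, η s p.1) (∑ s ∈ Finset.Iic t, η s p.1)} with hJ
  have hsm : ∀ a : Finset (Fin (T + 1)), Measurable fun p : Ω × ℝ => ∑ s ∈ a, η s p.1 :=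
    fun a => Finset.measurable_sum _ fun s _ => (hηm s).comp measurable_fst
  have hJm : ∀ t, MeasurableSet (J t) := fun t =>
    (measurableSet_lt (hsm _) measurable_snd).inter (measurableSet_le measurable_snd (hsm _))
  set F : Ω → ℝ → ℝ := fun ω u => ∑ t, h t ω * (J t).indicator 1 (ω, u) with hF
  have hFm : Measurable (Function.uncurry F) := Finset.measurable_sum _ fun t _ =>
    ((hhm t).comp measurable_fst).mul (measurable_one.indicator (hJm t))
  have hFi : Integrable (Function.uncurry F) (Q.prod (volume.restrict (Set.Ioc (0 : ℝ) 1))) := by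
    refine Integrable.of_bound hFm.aestronglyMeasurable (∑ _t : Fin (T + 1), C)
      (ae_of_all _ fun p => (norm_sum_le _ _).trans (Finset.sum_le_sum fun t _ => ?_))
    rw [norm_mul]
    refine (mul_le_of_le_one_right (norm_nonneg _) ?_).trans (hC t p.1)
    by_cases hp : (p.1, p.2) ∈ J t <;> simp [hp]
  have hinner : ∀ᵐ ω ∂Q, liquidationPayoff η h ω = ∫ u in Set.Ioc (0 : ℝ) 1, F ω u := by
    filter_upwards [hη.sum_eq_one] with ω hω
    have hind : ∀ t u, (J t).indicator (1 : Ω × ℝ → ℝ) (ω, u) =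
        (Set.Ioc (∑ s ∈ Finset.Iio t, η s ω) (∑ s ∈ Finset.Iic t, η s ω)).indicator 1 u :=
      fun t u => by simp only [hJ, Set.indicator_apply, Set.mem_ofPred_eq, Pi.one_apply]
    simp only [hF, hind]
    rw [integral_finsetSum]
    · refine Finset.sum_congr rfl fun t _ => ?_
      rw [integral_const_mul, integral_indicator_one measurableSet_Ioc,
        measureReal_restrict_apply measurableSet_Ioc, Set.inter_eq_left.2, Real.volume_real_Ioc]
      · have : Finset.Iic t = insert t (Finset.Iio t) := by
          ext s; simp [le_iff_eq_or_lt]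
        rw [this, Finset.sum_insert (by simp), add_sub_cancel_right, max_eq_left (hη.nonneg t ω)]
      · refine Set.Ioc_subset_Ioc (Finset.sum_nonneg fun s _ => hη.nonneg s ω) ?_
        rw [← hω]
        exact Finset.sum_le_sum_of_subset_of_nonneg (Finset.subset_univ _)
          fun s _ _ => hη.nonneg s ω
    · intro t _
      exact (((integrable_const (1 : ℝ)).indicator measurableSet_Ioc).const_mul _)
  have houter : ∀ u ∈ Set.Ioc (0 : ℝ) 1, ∫ ω, F ω u ∂Q ≤ Market.americanValue ℱ Q h := by
    intro u hu
    have heq : ∫ ω, F ω u ∂Q = ∫ ω, h (exerciseTime η u ω) ω ∂Q := by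
      refine integral_congr_ae ?_
      filter_upwards [hη.sum_eq_one] with ω hω
      have hind : ∀ t, (J t).indicator (1 : Ω × ℝ → ℝ) (ω, u) =
          if exerciseTime η u ω = t then 1 else 0 := fun t => by
        simp only [hJ, Set.indicator_apply, Set.mem_ofPred_eq, Pi.one_apply,
          exerciseTime_eq_iff hη.nonneg hu hω]
      simp [hF, hind]
    rw [heq]
    exact le_ciSup (bddAbove_integral_stopped hC)
      (⟨exerciseTime η u, isStoppingTime_exerciseTime hη.adapted hη.nonneg u⟩ :
        {τ : Ω → Fin (T + 1) //
          IsStoppingTime ℱ (fun ω => ((τ ω : Fin (T + 1)) : WithTop (Fin (T + 1))))})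
  rw [integral_congr_ae hinner, integral_integral_swap hFi]
  calc ∫ u in Set.Ioc (0 : ℝ) 1, ∫ ω, F ω u ∂Q
      ≤ ∫ _u in Set.Ioc (0 : ℝ) 1, Market.americanValue ℱ Q h :=
        setIntegral_mono_on hFi.integral_prod_right (integrable_const _) measurableSet_Ioc houter
    _ = Market.americanValue ℱ Q h := by simp

end Randomisation

/-! ### Pricing measures exclude arbitrage -/

section Pricing

variable {Ω : Type*} {mΩ : MeasurableSpace Ω} {P Q : Measure Ω} {T d L M N : ℕ}
  {ℱ : Filtration (Fin (T + 1)) mΩ}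

theorem IsLiquidating.of_ac {η : Fin (T + 1) → Ω → ℝ} (hη : IsLiquidating ℱ P η) (hQP : Q ≪ P) :
    IsLiquidating ℱ Q η :=
  ⟨hη.adapted, hη.nonneg, hQP.ae_le hη.sum_eq_one⟩

theorem integrable_liquidationPayoff [IsProbabilityMeasure Q] {η h : Fin (T + 1) → Ω → ℝ}
    (hη : IsLiquidating ℱ Q η) (hh : Adapted ℱ h) {C : ℝ} (hC : ∀ t ω, |h t ω| ≤ C) :
    Integrable (liquidationPayoff η h) Q := by
  have hm : Measurable (liquidationPayoff η h) := Finset.measurable_sum _ fun t _ =>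
    ((hh t).mono (ℱ.le t) le_rfl).mul ((hη.adapted t).mono (ℱ.le t) le_rfl)
  refine Integrable.of_bound hm.aestronglyMeasurable C ?_
  filter_upwards [hη.sum_eq_one] with ω hω
  calc ‖liquidationPayoff η h ω‖ ≤ ∑ t, ‖h t ω * η t ω‖ := norm_sum_le _ _
    _ ≤ ∑ t, C * η t ω := Finset.sum_le_sum fun t _ => by
        rw [norm_mul, Real.norm_of_nonneg (hη.nonneg t ω)]
        exact mul_le_mul_of_nonneg_right (hC t ω) (hη.nonneg t ω)
    _ = C := by rw [← Finset.mul_sum, hω, mul_one]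

namespace Market

variable (X : Market ℱ d L M N)

/-- The existence of a pricing measure implies strict no arbitrage: prices can be lowered to the values under `Q`, at
which the static part of any strategy has nonpositive expectation. -/
theorem strictNoArbitrage_of_nonempty (hQ : (X.pricingMeasures P).Nonempty) :
    X.StrictNoArbitrage P := by
  obtain ⟨Q, hQ, hf, hg, hh⟩ := hQ
  have := hQ.isProbabilityMeasure
  obtain ⟨Cg, hCg⟩ := X.bounded_g
  obtain ⟨Ch, hCh⟩ := X.bounded_h
  refine ⟨fun j => X.gbar j - ∫ ω, X.g j ω ∂Q,
    fun k => X.hbar k - americanValue ℱ Q (X.h k), fun j => sub_pos.2 (hg j),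
    fun k => sub_pos.2 (hh k), fun s hs => ?_⟩
  simp only [sub_sub_cancel] at hs ⊢
  have hgi : ∀ j, Integrable (X.g j) Q := fun j => Integrable.of_bound
    ((X.measurable_g j).mono (ℱ.le _) le_rfl).aestronglyMeasurable Cg (ae_of_all _ (hCg j))
  have hliq : ∀ k, IsLiquidating ℱ Q (s.μ k) := fun k => (s.liquidating k).of_ac hQ.ac
  have hhi : ∀ k, Integrable (liquidationPayoff (s.μ k) (X.h k)) Q := fun k =>
    integrable_liquidationPayoff (hliq k) (X.adapted_h k) (hCh k)
  have i1 : ∀ i, Integrable (fun ω => s.a i * (X.f i ω - X.fbar i)) Q := fun i =>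
    ((hf i).1.sub (integrable_const _)).const_mul _
  have i2 : ∀ j, Integrable (fun ω => s.b j * (X.g j ω - ∫ ω, X.g j ω ∂Q)) Q := fun j =>
    ((hgi j).sub (integrable_const _)).const_mul _
  have i3 : ∀ k, Integrable (fun ω => s.c k * (liquidationPayoff (s.μ k) (X.h k) ω -
      americanValue ℱ Q (X.h k))) Q := fun k => ((hhi k).sub (integrable_const _)).const_mul _
  have j1 := integrable_finsetSum Finset.univ fun i _ => i1 i
  have j2 := integrable_finsetSum Finset.univ fun j _ => i2 j
  have j3 := integrable_finsetSum Finset.univ fun k _ => i3 k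
  have hint := (j1.add j2).add j3
  have hle := tradingGain_add_eq_zero s.adapted_H hQ.martingale hint ?_ ?_
  · filter_upwards [hQ.ac'.ae_le hle] with ω hω
    rw [← hω]
    simp only [terminalValue, Pi.add_apply]
    ring
  · simp only [Pi.add_apply]
    rw [integral_add (by exact j1.add j2) j3, integral_add j1 j2,
      integral_finsetSum _ fun i _ => i1 i, integral_finsetSum _ fun j _ => i2 j,
      integral_finsetSum _ fun k _ => i3 k]
    have e1 : ∀ i, ∫ ω, s.a i * (X.f i ω - X.fbar i) ∂Q = 0 := fun i => by
      rw [integral_const_mul, integral_sub (hf i).1 (integrable_const _), (hf i).2]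
      simp
    have e2 : ∀ j, ∫ ω, s.b j * (X.g j ω - ∫ ω, X.g j ω ∂Q) ∂Q = 0 := fun j => by
      rw [integral_const_mul, integral_sub (hgi j) (integrable_const _)]
      simp
    have e3 : ∀ k, ∫ ω, s.c k * (liquidationPayoff (s.μ k) (X.h k) ω -
        americanValue ℱ Q (X.h k)) ∂Q ≤ 0 := fun k => by
      rw [integral_const_mul, integral_sub (hhi k) (integrable_const _)]
      have := integral_liquidationPayoff_le (hliq k) (X.adapted_h k) (hCh k)
      simp only [integral_const, probReal_univ, one_smul]
      exact mul_nonpos_of_nonneg_of_nonpos (s.c_nonneg k) (by linarith)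
    simp only [e1, e2, Finset.sum_const_zero, zero_add]
    exact Finset.sum_nonpos fun k _ => e3 k
  · filter_upwards [hQ.ac.ae_le hs] with ω hω
    simp only [terminalValue, Pi.add_apply] at hω ⊢
    linarith

/-! ### Gains from trading stocks and the options `f` -/

/-- The gains attainable without the options `g` and `h`. -/
def gains : Submodule ℝ (Ω → ℝ) where
  carrier := {Y | ∃ (H : Fin (T + 1) → Ω → EuclideanSpace ℝ (Fin d)) (a : Fin L → ℝ),
    Adapted ℱ H ∧ Y = fun ω => tradingGain H X.S ω + ∑ i, a i * (X.f i ω - X.fbar i)}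
  add_mem' := by
    rintro _ _ ⟨H, a, hH, rfl⟩ ⟨H', a', hH', rfl⟩
    refine ⟨fun t => H t + H' t, a + a', fun t => (hH t).add (hH' t), ?_⟩
    funext ω
    simp only [tradingGain, Pi.add_apply, inner_add_left, add_mul, Finset.sum_add_distrib]
    ring
  zero_mem' := ⟨0, 0, fun _ => measurable_const, by
    funext ω
    simp [tradingGain]⟩
  smul_mem' := by
    rintro c _ ⟨H, a, hH, rfl⟩
    refine ⟨fun t => c • H t, c • a, fun t => (hH t).const_smul c, ?_⟩
    funext ω
    simp only [tradingGain, Pi.smul_apply, real_inner_smul_left, smul_eq_mul, mul_assoc, mul_add,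
      Finset.mul_sum]

/-- The change of the price of the `i`-th stock in the `t`-th trading period. -/
def stockIncrement (t : Fin T) (i : Fin d) (ω : Ω) : ℝ :=
  X.S t.succ ω i - X.S t.castSucc ω i

/-- The gains from trading stocks from time `n` on. -/
def stockGainsFrom (n : ℕ) : Submodule ℝ (Ω → ℝ) :=
  Finset.sup (Finset.univ.filter fun t : Fin T => n ≤ t.val) fun t =>
    Finset.univ.sup fun i => multiples (ℱ t.castSucc) (X.stockIncrement t i)

theorem multiples_stockIncrement_le (t : Fin T) (i : Fin d) :
    multiples (ℱ t.castSucc) (X.stockIncrement t i) ≤ X.gains := by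
  rintro _ ⟨F, hF, rfl⟩
  refine ⟨fun s ω => if s = t.castSucc then F ω • EuclideanSpace.single i 1 else 0, 0,
    fun s => ?_, ?_⟩
  · by_cases hs : s = t.castSucc
    · subst hs
      simp only [if_true]
      exact hF.smul_const _
    · simp only [hs, if_false]
      exact measurable_const
  · funext ω
    simp only [tradingGain, Fin.castSucc_inj, Pi.zero_apply, zero_mul, Finset.sum_const_zero,
      add_zero, Pi.mul_apply, stockIncrement]
    rw [Finset.sum_eq_single t]
    · simp [real_inner_smul_left, EuclideanSpace.inner_single_left]
    · intro s _ hs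
      simp [hs]
    · simp

theorem multiples_option_le (i : Fin L) :
    multiples ⊥ (fun ω => X.f i ω - X.fbar i) ≤ X.gains := by
  rintro _ ⟨F, hF, rfl⟩
  rcases isEmpty_or_nonempty Ω with hΩ | hΩ
  · exact ⟨0, 0, fun _ => measurable_const, funext fun ω => (hΩ.false ω).elim⟩
  obtain ⟨a, rfl⟩ := stronglyMeasurable_bot_iff.1 hF.stronglyMeasurable
  refine ⟨0, Pi.single i a, fun _ => measurable_const, ?_⟩
  funext ω
  simp [tradingGain, Pi.single_apply]

theorem gains_eq : X.gains = X.stockGainsFrom 0 ⊔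
    Finset.univ.sup fun i => multiples ⊥ (fun ω => X.f i ω - X.fbar i) := by
  refine le_antisymm ?_ (sup_le (Finset.sup_le fun t _ => Finset.sup_le fun i _ =>
    X.multiples_stockIncrement_le t i) (Finset.sup_le fun i _ => X.multiples_option_le i))
  rintro _ ⟨H, a, hH, rfl⟩
  refine Submodule.add_mem_sup (S := X.stockGainsFrom 0) ?_ ?_
  · have heq : tradingGain H X.S = ∑ t : Fin T, ∑ i : Fin d,
        (fun ω => H t.castSucc ω i) * X.stockIncrement t i := by
      funext ω
      simp only [tradingGain, Finset.sum_apply, Pi.mul_apply, stockIncrement, PiLp.inner_apply,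
        PiLp.sub_apply, Real.inner_apply]
    change tradingGain H X.S ∈ _
    rw [heq]
    refine Submodule.sum_mem _ fun t _ => Submodule.sum_mem _ fun i _ => ?_
    have h1 : multiples (ℱ t.castSucc) (X.stockIncrement t i) ≤
        Finset.univ.sup fun i => multiples (ℱ t.castSucc) (X.stockIncrement t i) :=
      Finset.le_sup (f := fun i => multiples (ℱ t.castSucc) (X.stockIncrement t i))
        (Finset.mem_univ i)
    have h2 : (Finset.univ.sup fun i => multiples (ℱ t.castSucc) (X.stockIncrement t i)) ≤
        X.stockGainsFrom 0 :=
      Finset.le_sup (f := fun t : Fin T => Finset.univ.sup fun i =>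
        multiples (ℱ t.castSucc) (X.stockIncrement t i)) (by simp)
    refine h2 (h1 ⟨_, ?_, rfl⟩)
    exact (EuclideanSpace.proj (𝕜 := ℝ) i).continuous.measurable.comp (hH t.castSucc)
  · have heq : (fun ω => ∑ i, a i * (X.f i ω - X.fbar i)) =
        ∑ i, (fun _ => a i) * fun ω => X.f i ω - X.fbar i := by
      funext ω
      simp
    rw [heq]
    refine Submodule.sum_mem _ fun i _ => ?_
    exact Finset.le_sup (f := fun i => multiples ⊥ (fun ω => X.f i ω - X.fbar i))
      (Finset.mem_univ i) ⟨_, measurable_const, rfl⟩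

/-- Without arbitrage, the claims dominated by gains from the stocks and the options `f` are closed
under almost sure convergence. The stock gains are added backwards in time, so that the information
used by the new strategies decreases; the options `f` are traded on trivial information. -/
theorem isStableClosed_gains (hNA : ∀ k ∈ X.gains, 0 ≤ᵐ[P] k → k =ᵐ[P] 0) :
    IsStableClosed P ⊥ X.gains := by
  have hstock : ∀ n, X.stockGainsFrom n ≤ X.gains := fun n =>
    Finset.sup_le fun t _ => Finset.sup_le fun i _ => X.multiples_stockIncrement_le t i
  have key : ∀ n (hn : n ≤ T), IsStableClosed P (ℱ ⟨n, by omega⟩) (X.stockGainsFrom n) := by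
    intro n hn
    induction hn using Nat.decreasingInduction with
    | self =>
      have : (Finset.univ.filter fun t : Fin T => T ≤ t.val) = ∅ := by
        ext t
        simp
      rw [stockGainsFrom, this, Finset.sup_empty]
      exact IsStableClosed.bot _ _
    | of_succ n hn ih =>
      have hfil : (Finset.univ.filter fun t : Fin T => n ≤ t.val) =
          insert ⟨n, hn⟩ (Finset.univ.filter fun t : Fin T => n + 1 ≤ t.val) := by
        ext t
        simp only [Finset.mem_filter, Finset.mem_univ, true_and, Finset.mem_insert, Fin.ext_iff]
        omega
      have heq : X.stockGainsFrom n = X.stockGainsFrom (n + 1) ⊔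
          Finset.univ.sup fun i => multiples (ℱ ⟨n, by omega⟩) (X.stockIncrement ⟨n, hn⟩ i) := by
        rw [stockGainsFrom, hfil, Finset.sup_insert, sup_comm]
        rfl
      have hle : ℱ ⟨n, by omega⟩ ≤ ℱ ⟨n + 1, by omega⟩ := ℱ.mono (by simp [Fin.le_def])
      rw [heq]
      exact (ih.mono hle).sup_finset_multiples _ _ fun k hk => hNA k (hstock n (heq ▸ hk))
  have h0 := (key 0 (Nat.zero_le _)).mono (𝒢' := ⊥) bot_le
  have heq := X.gains_eq
  rw [heq]
  exact h0.sup_finset_multiples _ _ fun k hk => hNA k (heq ▸ hk)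

end Market

end Pricing

/-! ### The polar of the weighted superreplicable claims -/

section Weighted

variable {Ω : Type*} {𝒢 mΩ : MeasurableSpace Ω}

/-- The square integrable functions `Y` for which the claim `Y / w` is dominated by an element of
`K`. A small weight `w > 0` brings unbounded claims into `L²(P)`. -/
def weightedClaims (P : Measure Ω) (K : Submodule ℝ (Ω → ℝ)) (w : Ω → ℝ) : Set (Lp ℝ 2 P) :=
  {Y | ∃ k ∈ K, Y ≤ᵐ[P] w * k}

variable {P : Measure Ω} {K : Submodule ℝ (Ω → ℝ)} {w : Ω → ℝ}

theorem convex_weightedClaims : Convex ℝ (weightedClaims P K w) := by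
  rintro Y ⟨k, hk, hY⟩ Y' ⟨k', hk', hY'⟩ s t hs ht _
  refine ⟨s • k + t • k', K.add_mem (K.smul_mem _ hk) (K.smul_mem _ hk'), ?_⟩
  filter_upwards [hY, hY', Lp.coeFn_add (s • Y) (t • Y'), Lp.coeFn_smul s Y, Lp.coeFn_smul t Y']
    with ω h1 h2 h3 h4 h5
  rw [h3, Pi.add_apply, h4, h5]
  simp only [Pi.mul_apply, Pi.smul_apply, smul_eq_mul, Pi.add_apply] at h1 h2 ⊢
  have h6 := mul_le_mul_of_nonneg_left h1 hs
  have h7 := mul_le_mul_of_nonneg_left h2 ht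
  linarith

theorem smul_mem_weightedClaims {Y : Lp ℝ 2 P} (hY : Y ∈ weightedClaims P K w) {t : ℝ}
    (ht : 0 ≤ t) : t • Y ∈ weightedClaims P K w := by
  obtain ⟨k, hk, hY⟩ := hY
  refine ⟨t • k, K.smul_mem _ hk, ?_⟩
  filter_upwards [hY, Lp.coeFn_smul t Y] with ω h1 h2
  rw [h2]
  simp only [Pi.mul_apply, Pi.smul_apply, smul_eq_mul] at h1 ⊢
  have := mul_le_mul_of_nonneg_left h1 ht
  linarith

theorem mem_weightedClaims_of_nonpos {Y : Lp ℝ 2 P} (hY : Y ≤ᵐ[P] 0) :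
    Y ∈ weightedClaims P K w :=
  ⟨0, K.zero_mem, by rwa [mul_zero]⟩

theorem zero_mem_weightedClaims : (0 : Lp ℝ 2 P) ∈ weightedClaims P K w :=
  mem_weightedClaims_of_nonpos (Lp.coeFn_zero ℝ 2 P).le

theorem isClosed_weightedClaims (hK : IsStableClosed P 𝒢 K)
    (hw : ∀ ω, 0 < w ω) : IsClosed (weightedClaims P K w) := by
  refine IsSeqClosed.isClosed fun Y Z hY hZ => ?_
  obtain ⟨ns, -, hns⟩ := (tendstoInMeasure_of_tendsto_Lp hZ).exists_seq_tendsto_ae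
  choose k hk hle using hY
  obtain ⟨k₀, hk₀, hle₀⟩ := hK.closed (X := fun n ω => (w ω)⁻¹ * Y (ns n) ω)
    (Y := fun ω => (w ω)⁻¹ * Z ω) (fun n => hk (ns n))
    (fun n => by
      filter_upwards [hle (ns n)] with ω hω
      exact (inv_mul_le_iff₀ (hw ω)).2 hω)
    (by
      filter_upwards [hns] with ω hω
      exact hω.const_mul _)
  refine ⟨k₀, hk₀, ?_⟩
  filter_upwards [hle₀] with ω hω
  exact (inv_mul_le_iff₀ (hw ω)).1 hω

/-- The set contains all nonpositive functions, so that vectors of its polar are nonnegative. -/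
theorem nonneg_of_mem_polar [IsFiniteMeasure P] {z : Lp ℝ 2 P}
    (hz : ∀ Y ∈ weightedClaims P K w, inner ℝ z Y ≤ 0) : 0 ≤ᵐ[P] z := by
  refine ae_nonneg_of_forall_setIntegral_nonneg ((Lp.memLp z).integrable (by norm_num))
    fun s hs hPs => ?_
  have h1 := hz (-indicatorConstLp 2 hs hPs.ne (1 : ℝ)) (mem_weightedClaims_of_nonpos (by
    filter_upwards [Lp.coeFn_neg (indicatorConstLp 2 hs hPs.ne (1 : ℝ)),
      indicatorConstLp_coeFn (p := 2) (hs := hs) (hμs := hPs.ne) (c := (1 : ℝ))] with ω h1 h2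
    rw [h1, Pi.neg_apply, h2, Pi.zero_apply, neg_nonpos]
    exact Set.indicator_nonneg (fun _ _ => zero_le_one) ω))
  rw [inner_neg_right, real_inner_comm, L2.inner_indicatorConstLp_one hs hPs.ne] at h1
  linarith

/-- Without arbitrage in `K`, the polar contains a strictly positive function. -/
theorem exists_polar_pos [IsFiniteMeasure P] [IsSeparable P]
    (hK : IsStableClosed P 𝒢 K) (hNA : ∀ k ∈ K, 0 ≤ᵐ[P] k → k =ᵐ[P] 0) (hw : ∀ ω, 0 < w ω) :
    ∃ z : Lp ℝ 2 P, (∀ Y ∈ weightedClaims P K w, inner ℝ z Y ≤ 0) ∧ ∀ᵐ ω ∂P, 0 < z ω := by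
  have : Fact ((2 : ℝ≥0∞) ≠ ∞) := ⟨by norm_num⟩
  obtain ⟨z, hz, hpos⟩ := exists_polar_inner_pos (isClosed_weightedClaims hK hw)
    convex_weightedClaims zero_mem_weightedClaims fun Y hY t ht => smul_mem_weightedClaims hY ht
  refine ⟨z, hz, ?_⟩
  have hs : MeasurableSet {ω | z ω = 0} :=
    (Lp.stronglyMeasurable z).measurable (measurableSet_singleton 0)
  have hPs : P {ω | z ω = 0} ≠ ∞ := measure_ne_top _ _
  have hcoe := indicatorConstLp_coeFn (p := 2) (hs := hs) (hμs := hPs) (c := (1 : ℝ))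
  have hinner : inner ℝ z (indicatorConstLp 2 hs hPs (1 : ℝ)) = 0 := by
    rw [real_inner_comm, L2.inner_indicatorConstLp_one hs hPs]
    exact setIntegral_eq_zero_of_forall_eq_zero fun ω hω => hω
  have hmem : indicatorConstLp 2 hs hPs (1 : ℝ) ∈ weightedClaims P K w := by
    by_contra hnot
    -- Otherwise the polar vector would be positive on the indicator of its own zero set.
    refine (hpos _ (mem_weightedClaims_of_nonpos ?_) hnot).ne' hinner
    filter_upwards [Lp.coeFn_neg (indicatorConstLp 2 hs hPs (1 : ℝ)), hcoe] with ω h1 h2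
    rw [h1, Pi.neg_apply, h2, Pi.zero_apply, neg_nonpos]
    exact Set.indicator_nonneg (fun _ _ => zero_le_one) ω
  obtain ⟨k, hk, hle⟩ := hmem
  have hk0 := hNA k hk (by
    filter_upwards [hle, hcoe] with ω h1 h2
    rw [h2] at h1
    have h3 : 0 ≤ w ω * k ω := (Set.indicator_nonneg (fun _ _ => zero_le_one) ω).trans h1
    exact nonneg_of_mul_nonneg_right h3 (hw ω))
  filter_upwards [hle, hcoe, hk0, nonneg_of_mem_polar hz] with ω h1 h2 h3 h4
  refine lt_of_le_of_ne h4 fun h5 => ?_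
  have h6 : ω ∈ {ω | z ω = 0} := h5.symm
  rw [h2, Pi.mul_apply, h3, Set.indicator_of_mem h6] at h1
  simp only [Pi.zero_apply, mul_zero] at h1
  linarith

end Weighted

/-! ### Positions in the options `g` and `h` -/

section Positions

variable {Ω : Type*} {mΩ : MeasurableSpace Ω} {P : Measure Ω} {T M N : ℕ}

theorem isClosed_lpMeas {m m₀ : MeasurableSpace Ω} {μ : Measure[m₀] Ω} (hm : m ≤ m₀) :
    IsClosed (lpMeas ℝ ℝ m 2 μ : Set (Lp ℝ 2 μ)) :=
  isClosed_aestronglyMeasurable hm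

theorem Lp_smul_nonneg {s : ℝ} (hs : 0 ≤ s) {y : Lp ℝ 2 P} (hy : 0 ≤ y) : 0 ≤ s • y := by
  rw [← Lp.coeFn_nonneg] at hy ⊢
  filter_upwards [hy, Lp.coeFn_smul s y] with ω h1 h2
  rw [h2]
  exact mul_nonneg hs h1

theorem coeFn_finset_sum {ι : Type*} (s : Finset ι) (x : ι → Lp ℝ 2 P) :
    ⇑(∑ i ∈ s, x i) =ᵐ[P] fun ω => ∑ i ∈ s, x i ω := by
  classical
  induction s using Finset.induction_on with
  | empty =>
    simp only [Finset.sum_empty]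
    exact Lp.coeFn_zero ℝ 2 P
  | insert i s hi ih =>
    rw [Finset.sum_insert hi]
    filter_upwards [Lp.coeFn_add (x i) (∑ i ∈ s, x i), ih] with ω h1 h2
    rw [h1, Pi.add_apply, h2, Finset.sum_insert hi]

/-- The payoff `∑ᵢ Gᵢ xᵢ` of holding the random quantities `xᵢ ∈ L²(P)` of finitely many bounded
claims `Gᵢ`, as a continuous linear map. -/
noncomputable def positionPayoff {ι : Type*} [Fintype ι] {G : ι → Ω → ℝ}
    (hG : ∀ i, MemLp (G i) ∞ P) :
    PiLp 2 (fun _ : ι => Lp ℝ 2 P) →L[ℝ] Lp ℝ 2 P :=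
  ∑ i, ((ContinuousLinearMap.mul ℝ ℝ).holderL P ∞ 2 2 ((hG i).toLp (G i))) ∘L
    PiLp.proj 2 (fun _ : ι => Lp ℝ 2 P) i

theorem coeFn_positionPayoff {ι : Type*} [Fintype ι] {G : ι → Ω → ℝ}
    (hG : ∀ i, MemLp (G i) ∞ P) (x : PiLp 2 fun _ : ι => Lp ℝ 2 P) :
    positionPayoff hG x =ᵐ[P] fun ω => ∑ i, G i ω * x i ω := by
  have h1 : positionPayoff hG x = ∑ i, (ContinuousLinearMap.mul ℝ ℝ).holder 2
      ((hG i).toLp (G i)) (x i) := by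
    simp only [positionPayoff, sum_apply]
    rfl
  rw [h1]
  filter_upwards [coeFn_finset_sum Finset.univ fun i => (ContinuousLinearMap.mul ℝ ℝ).holder 2
      ((hG i).toLp (G i)) (x i),
    ae_all_iff.2 fun i => (ContinuousLinearMap.mul ℝ ℝ).coeFn_holder (r := 2)
      ((hG i).toLp (G i)) (x i), ae_all_iff.2 fun i => (hG i).coeFn_toLp] with ω h2 h3 h4
  rw [h2]
  refine Finset.sum_congr rfl fun i _ => ?_
  rw [h3, h4]
  rfl

/-- Normalised positions in `M` European and `N` American options. The coordinate `Sum.inl j` is the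
number of units of the `j`-th European option, and `Sum.inr (k, t)` is the number of units of the
`k`-th American option which are exercised at time `t`. Measurability with respect to `⊥` expresses
that a quantity is deterministic; the total number of options held is `1`. -/
def positions (ℱ : Filtration (Fin (T + 1)) mΩ) (P : Measure Ω) [IsFiniteMeasure P] (M N : ℕ) :
    Set (PiLp 2 fun _ : Fin M ⊕ (Fin N × Fin (T + 1)) => Lp ℝ 2 P) :=
  {x | (∀ i, 0 ≤ x i) ∧ (∀ j, x (Sum.inl j) ∈ lpMeas ℝ ℝ ⊥ 2 P) ∧
    (∀ k t, x (Sum.inr (k, t)) ∈ lpMeas ℝ ℝ (ℱ t) 2 P) ∧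
    (∀ k, ∑ t, x (Sum.inr (k, t)) ∈ lpMeas ℝ ℝ ⊥ 2 P) ∧ ∑ i, x i = Lp.const 2 P (1 : ℝ)}

variable {ℱ : Filtration (Fin (T + 1)) mΩ}

/-- A position in one American option is a multiple of a liquidating strategy. -/
theorem exists_isLiquidating_mul_eq {θ : Fin (T + 1) → Ω → ℝ} {c : ℝ} (hc : 0 ≤ c)
    (hθ : ∀ t, AEStronglyMeasurable[ℱ t] (θ t) P) (hθ0 : ∀ t, 0 ≤ᵐ[P] θ t)
    (hsum : ∀ᵐ ω ∂P, ∑ t, θ t ω = c) :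
    ∃ μ : Fin (T + 1) → Ω → ℝ, IsLiquidating ℱ P μ ∧ ∀ᵐ ω ∂P, ∀ t, c * μ t ω = θ t ω := by
  rcases hc.eq_or_lt with rfl | hc
  · refine ⟨fun t _ => if t = 0 then 1 else 0, ⟨fun t => measurable_const, fun t ω => ?_,
      ae_of_all _ fun ω => by simp⟩, ?_⟩
    · split_ifs <;> norm_num
    · filter_upwards [hsum, ae_all_iff.2 hθ0] with ω h1 h2 t
      rw [zero_mul, (Finset.sum_eq_zero_iff_of_nonneg fun t _ => h2 t).1 h1 t (Finset.mem_univ t)]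
  · have hae : ∀ᵐ ω ∂P, ∀ t, c * (c⁻¹ * max ((hθ t).mk (θ t) ω) 0) = θ t ω := by
      filter_upwards [ae_all_iff.2 fun t => (hθ t).ae_eq_mk, ae_all_iff.2 hθ0] with ω h1 h2 t
      rw [← h1 t, max_eq_left (by exact h2 t), mul_inv_cancel_left₀ hc.ne']
    refine ⟨fun t ω => c⁻¹ * max ((hθ t).mk (θ t) ω) 0, ⟨fun t => ?_, fun t ω => by positivity,
      ?_⟩, hae⟩
    · exact ((hθ t).stronglyMeasurable_mk.measurable.max measurable_const).const_mul _
    · filter_upwards [hae, hsum] with ω h1 h2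
      simp only [← h1, ← Finset.mul_sum] at h2
      rw [← Finset.mul_sum]
      exact mul_left_cancel₀ hc.ne' (by rw [h2, mul_one])

variable [IsProbabilityMeasure P]

theorem isClosed_positions : IsClosed (positions ℱ P M N) := by
  have hc : ∀ i, Continuous fun x : PiLp 2 fun _ : Fin M ⊕ (Fin N × Fin (T + 1)) => Lp ℝ 2 P =>
    x i := fun i => PiLp.continuous_apply 2 _ i
  simp only [positions, Set.ofPred_and, Set.ofPred_forall]
  refine IsClosed.inter ?_ (IsClosed.inter ?_ (IsClosed.inter ?_ (IsClosed.inter ?_ ?_)))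
  · exact isClosed_iInter fun i => isClosed_le continuous_const (hc i)
  · exact isClosed_iInter fun j => (isClosed_lpMeas bot_le).preimage (hc (Sum.inl j))
  · exact isClosed_iInter fun k => isClosed_iInter fun t =>
      (isClosed_lpMeas (ℱ.le t)).preimage (hc (Sum.inr (k, t)))
  · exact isClosed_iInter fun k => (isClosed_lpMeas bot_le).preimage
      (continuous_finsetSum _ fun t _ => hc (Sum.inr (k, t)))
  · exact isClosed_eq (continuous_finsetSum _ fun i _ => hc i) continuous_const

theorem convex_positions : Convex ℝ (positions ℱ P M N) := by
  rintro x ⟨h1, h2, h3, h4, h5⟩ y ⟨g1, g2, g3, g4, g5⟩ s t hs ht hst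
  refine ⟨fun i => ?_, fun j => ?_, fun k u => ?_, fun k => ?_, ?_⟩
  · exact add_nonneg (Lp_smul_nonneg hs (h1 i)) (Lp_smul_nonneg ht (g1 i))
  · exact Submodule.add_mem _ (Submodule.smul_mem _ _ (h2 j)) (Submodule.smul_mem _ _ (g2 j))
  · exact Submodule.add_mem _ (Submodule.smul_mem _ _ (h3 k u)) (Submodule.smul_mem _ _ (g3 k u))
  · simp only [PiLp.add_apply, PiLp.smul_apply, Finset.sum_add_distrib, ← Finset.smul_sum]
    exact Submodule.add_mem _ (Submodule.smul_mem _ _ (h4 k)) (Submodule.smul_mem _ _ (g4 k))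
  · simp only [PiLp.add_apply, PiLp.smul_apply, Finset.sum_add_distrib, ← Finset.smul_sum]
    rw [h5, g5, ← add_smul, hst, one_smul]

theorem norm_le_of_mem_positions {x : PiLp 2 fun _ : Fin M ⊕ (Fin N × Fin (T + 1)) => Lp ℝ 2 P}
    (hx : x ∈ positions ℱ P M N) :
    ‖x‖ ≤ √(Fintype.card (Fin M ⊕ (Fin N × Fin (T + 1)))) := by
  obtain ⟨h1, -, -, -, h5⟩ := hx
  have hle : ∀ i, ‖x i‖ ≤ 1 := by
    intro i
    have hi : x i ≤ Lp.const 2 P (1 : ℝ) := by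
      rw [← h5]
      exact Finset.single_le_sum (fun j _ => h1 j) (Finset.mem_univ i)
    have := Lp.norm_le_of_ae_bound (f := x i) zero_le_one (by
      filter_upwards [(Lp.coeFn_nonneg _).2 (h1 i), (Lp.coeFn_le _ _).2 hi,
        Lp.coeFn_const 2 P (1 : ℝ)] with ω h6 h7 h8
      rw [h8] at h7
      rw [Real.norm_of_nonneg h6]
      exact h7)
    simpa [measureUnivNNReal] using this
  refine Real.le_sqrt_of_sq_le ?_
  rw [PiLp.norm_sq_eq_of_L2]
  refine (Finset.sum_le_sum fun i _ => pow_le_one₀ (n := 2) (norm_nonneg _) (hle i)).trans ?_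
  simp

theorem ae_eq_const_of_mem_lpMeas_bot {y : Lp ℝ 2 P} (hy : y ∈ lpMeas ℝ ℝ ⊥ 2 P) :
    ∃ c : ℝ, y =ᵐ[P] fun _ => c := by
  have hΩ : Nonempty Ω := nonempty_of_isProbabilityMeasure P
  obtain ⟨g, hg, heq⟩ := mem_lpMeas_iff_aestronglyMeasurable.1 hy
  obtain ⟨c, rfl⟩ := stronglyMeasurable_bot_iff.1 hg
  exact ⟨c, heq⟩

end Positions

/-! ### Separating the positions from the superreplicable claims -/

section Separation

variable {Ω : Type*} {mΩ : MeasurableSpace Ω} {P : Measure Ω} {T d L M N : ℕ}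
  {ℱ : Filtration (Fin (T + 1)) mΩ}

namespace Market

variable (X : Market ℱ d L M N)

/-- The net payoffs of one unit of the options `g`, and of one unit of the options `h` exercised at
a given time, when they are bought at the prices `gbar` and `hbar`. -/
def optionPayoff : Fin M ⊕ (Fin N × Fin (T + 1)) → Ω → ℝ :=
  Sum.elim (fun j ω => X.g j ω - X.gbar j) fun p ω => X.h p.1 p.2 ω - X.hbar p.1

/-- A weight in `(0, 1]` which turns the stock prices and the options `f` into bounded functions. -/
noncomputable def weight (ω : Ω) : ℝ :=
  (1 + ∑ t, ‖X.S t ω‖ + ∑ i, |X.f i ω|)⁻¹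

theorem weight_pos (ω : Ω) : 0 < X.weight ω := by
  unfold weight
  positivity

theorem weight_mul_le_one {ω : Ω} {y : ℝ} (hy : y ≤ 1 + ∑ t, ‖X.S t ω‖ + ∑ i, |X.f i ω|) :
    X.weight ω * y ≤ 1 := by
  rw [weight, inv_mul_le_one₀ (by positivity)]
  exact hy

theorem weight_le_one (ω : Ω) : X.weight ω ≤ 1 := by
  have h1 : 0 ≤ ∑ t, ‖X.S t ω‖ := by positivity
  have h2 : 0 ≤ ∑ i, |X.f i ω| := by positivity
  have := X.weight_mul_le_one (ω := ω) (y := 1) (by linarith)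
  rwa [mul_one] at this

theorem weight_mul_norm_stock_le (t : Fin (T + 1)) (ω : Ω) : X.weight ω * ‖X.S t ω‖ ≤ 1 := by
  refine X.weight_mul_le_one ?_
  have h1 := Finset.single_le_sum (f := fun t => ‖X.S t ω‖) (fun _ _ => norm_nonneg _)
    (Finset.mem_univ t)
  have h2 : 0 ≤ ∑ i, |X.f i ω| := by positivity
  linarith

theorem weight_mul_abs_option_le (i : Fin L) (ω : Ω) : X.weight ω * |X.f i ω| ≤ 1 := by
  refine X.weight_mul_le_one ?_
  have h1 := Finset.single_le_sum (f := fun i => |X.f i ω|) (fun _ _ => abs_nonneg _)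
    (Finset.mem_univ i)
  have h2 : 0 ≤ ∑ t, ‖X.S t ω‖ := by positivity
  linarith

theorem measurable_stock (t : Fin (T + 1)) : Measurable (X.S t) :=
  (X.adapted_S t).mono (ℱ.le t) le_rfl

theorem measurable_option (i : Fin L) : Measurable (X.f i) :=
  (X.measurable_f i).mono (ℱ.le _) le_rfl

theorem measurable_weight : Measurable X.weight :=
  ((measurable_const.add (Finset.measurable_sum _ fun t _ => (X.measurable_stock t).norm)).add
    (Finset.measurable_sum _ fun i _ => (X.measurable_option i).abs)).inv

theorem measurable_optionPayoff (i : Fin M ⊕ (Fin N × Fin (T + 1))) :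
    Measurable (X.optionPayoff i) := by
  rcases i with j | ⟨k, t⟩
  · exact ((X.measurable_g j).mono (ℱ.le _) le_rfl).sub measurable_const
  · exact ((X.adapted_h k t).mono (ℱ.le _) le_rfl).sub measurable_const

theorem exists_abs_optionPayoff_le (i : Fin M ⊕ (Fin N × Fin (T + 1))) :
    ∃ C, ∀ ω, |X.optionPayoff i ω| ≤ C := by
  rcases i with j | ⟨k, t⟩
  · obtain ⟨C, hC⟩ := X.bounded_g
    exact ⟨C + |X.gbar j|, fun ω => (abs_sub _ _).trans (by gcongr; exact hC j ω)⟩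
  · obtain ⟨C, hC⟩ := X.bounded_h
    exact ⟨C + |X.hbar k|, fun ω => (abs_sub _ _).trans (by gcongr; exact hC k t ω)⟩

theorem memLp_weight_mul_optionPayoff (i : Fin M ⊕ (Fin N × Fin (T + 1))) :
    MemLp (X.weight * X.optionPayoff i) ∞ P := by
  obtain ⟨C, hC⟩ := X.exists_abs_optionPayoff_le i
  refine memLp_top_of_bound
    (X.measurable_weight.mul (X.measurable_optionPayoff i)).aestronglyMeasurable C
    (ae_of_all _ fun ω => ?_)
  rw [Pi.mul_apply, norm_mul, Real.norm_of_nonneg (X.weight_pos ω).le]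
  exact (mul_le_of_le_one_left (norm_nonneg _) (X.weight_le_one ω)).trans (hC ω)

theorem eq_zero_of_mem_gains {gp : Fin M → ℝ} {hp : Fin N → ℝ} (hX : X.NoArbitrage P gp hp) :
    ∀ k ∈ X.gains, 0 ≤ᵐ[P] k → k =ᵐ[P] 0 := by
  rintro _ ⟨H, a, hH, rfl⟩ hpos
  have := hX
    { H := H, a := a, b := 0, c := 0, μ := fun _ t _ => if t = 0 then 1 else 0
      adapted_H := hH
      b_nonneg := fun _ => le_rfl
      c_nonneg := fun _ => le_rfl
      liquidating := fun _ => ⟨fun _ => measurable_const,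
        fun t ω => by split_ifs <;> norm_num, ae_of_all _ fun ω => by simp⟩ }
  simp only [terminalValue, Pi.zero_apply, zero_mul, Finset.sum_const_zero, add_zero] at this
  exact this hpos

/-- Under strict no arbitrage, no normalised position in the options `g` and `h` can be
superhedged: at the strictly lower prices this would leave a positive profit. -/
theorem neg_positionPayoff_notMem [IsProbabilityMeasure P] (hX : X.StrictNoArbitrage P)
    {x : PiLp 2 fun _ : Fin M ⊕ (Fin N × Fin (T + 1)) => Lp ℝ 2 P}
    (hx : x ∈ positions ℱ P M N) :
    -positionPayoff X.memLp_weight_mul_optionPayoff x ∉ weightedClaims P X.gains X.weight := by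
  rintro ⟨_, ⟨H, a, hH, rfl⟩, hle⟩
  obtain ⟨εg, εh, hεg, hεh, hNA⟩ := hX
  obtain ⟨x0, xg, xh, xsum, xone⟩ := hx
  choose b hb using fun j => ae_eq_const_of_mem_lpMeas_bot (xg j)
  choose c hc using fun k => ae_eq_const_of_mem_lpMeas_bot (xsum k)
  have hc' : ∀ k, ∀ᵐ ω ∂P, ∑ t, x (Sum.inr (k, t)) ω = c k := fun k => by
    filter_upwards [hc k, coeFn_finset_sum Finset.univ fun t => x (Sum.inr (k, t))] with ω h1 h2
    rw [← h2, h1]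
  have hone : ∀ᵐ ω ∂P, ∑ i, x i ω = 1 := by
    filter_upwards [coeFn_finset_sum Finset.univ fun i => x i, Lp.coeFn_const 2 P (1 : ℝ)]
      with ω h1 h2
    rw [← h1, xone, h2]
    rfl
  have h0 : ∀ᵐ ω ∂P, ∀ i, 0 ≤ x i ω := ae_all_iff.2 fun i => (Lp.coeFn_nonneg _).2 (x0 i)
  have hball : ∀ᵐ ω ∂P, ∀ j, x (Sum.inl j) ω = b j := ae_all_iff.2 hb
  have hcall : ∀ᵐ ω ∂P, ∀ k, ∑ t, x (Sum.inr (k, t)) ω = c k := ae_all_iff.2 hc'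
  obtain ⟨hb0, hc0, hbc⟩ : (∀ j, 0 ≤ b j) ∧ (∀ k, 0 ≤ c k) ∧ ∑ j, b j + ∑ k, c k = 1 := by
    obtain ⟨ω, h1, h2, h3, h4⟩ := (h0.and (hball.and (hcall.and hone))).exists
    refine ⟨fun j => h2 j ▸ h1 _, fun k => h3 k ▸ Finset.sum_nonneg fun t _ => h1 _, ?_⟩
    rw [Fintype.sum_sum_type, Fintype.sum_prod_type] at h4
    simpa only [h2, h3] using h4
  choose μ hμ hμx using fun k => exists_isLiquidating_mul_eq (ℱ := ℱ) (hc0 k)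
    (fun t => mem_lpMeas_iff_aestronglyMeasurable.1 (xh k t))
    (fun t => (Lp.coeFn_nonneg _).2 (x0 (Sum.inr (k, t)))) (hc' k)
  set r : ℝ := ∑ j, b j * εg j + ∑ k, c k * εh k with hr
  have hbε : ∀ j, 0 ≤ b j * εg j := fun j => mul_nonneg (hb0 j) (hεg j).le
  have hcε : ∀ k, 0 ≤ c k * εh k := fun k => mul_nonneg (hc0 k) (hεh k).le
  have hr0 : 0 < r := by
    refine lt_of_le_of_ne (add_nonneg (Finset.sum_nonneg fun j _ => hbε j)
      (Finset.sum_nonneg fun k _ => hcε k)) fun hr0 => ?_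
    obtain ⟨h1, h2⟩ := (add_eq_zero_iff_of_nonneg (Finset.sum_nonneg fun j _ => hbε j)
      (Finset.sum_nonneg fun k _ => hcε k)).1 hr0.symm
    rw [Finset.sum_eq_zero_iff_of_nonneg fun j _ => hbε j] at h1
    rw [Finset.sum_eq_zero_iff_of_nonneg fun k _ => hcε k] at h2
    have h3 : ∀ j, b j = 0 := fun j =>
      (mul_eq_zero.1 (h1 j (Finset.mem_univ j))).resolve_right (hεg j).ne'
    have h4 : ∀ k, c k = 0 := fun k =>
      (mul_eq_zero.1 (h2 k (Finset.mem_univ k))).resolve_right (hεh k).ne'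
    simp [h3, h4] at hbc
  set s : Strategy ℱ P d L M N :=
    { H := H, a := a, b := b, c := c, μ := μ, adapted_H := hH, b_nonneg := hb0, c_nonneg := hc0
      liquidating := hμ }
  have hval : ∀ᵐ ω ∂P, r ≤ X.terminalValue (fun j => X.gbar j - εg j)
      (fun k => X.hbar k - εh k) s ω := by
    filter_upwards [hle, Lp.coeFn_neg (positionPayoff X.memLp_weight_mul_optionPayoff x),
      coeFn_positionPayoff X.memLp_weight_mul_optionPayoff x, hball, hcall, ae_all_iff.2 hμx]
      with ω h1 h2 h3 h4 h5 h6
    rw [h2, Pi.neg_apply, h3] at h1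
    simp only [Pi.mul_apply, mul_assoc, ← Finset.mul_sum] at h1
    have h7 : 0 ≤ X.weight ω * ((tradingGain H X.S ω + ∑ i, a i * (X.f i ω - X.fbar i)) +
        ∑ i, X.optionPayoff i ω * x i ω) := by
      rw [mul_add]
      linarith
    have h8 := nonneg_of_mul_nonneg_right h7 (X.weight_pos ω)
    have h9 : ∀ k, c k * (liquidationPayoff (μ k) (X.h k) ω - (X.hbar k - εh k)) =
        ∑ t, X.optionPayoff (Sum.inr (k, t)) ω * x (Sum.inr (k, t)) ω + c k * εh k := by
      intro k
      simp only [optionPayoff, Sum.elim_inr, sub_mul, Finset.sum_sub_distrib, ← Finset.mul_sum,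
        h5 k, liquidationPayoff]
      simp only [← h6 k]
      rw [mul_sub, Finset.mul_sum]
      simp only [mul_left_comm (c k)]
      ring
    have h10 : ∀ j, b j * (X.g j ω - (X.gbar j - εg j)) =
        X.optionPayoff (Sum.inl j) ω * x (Sum.inl j) ω + b j * εg j := by
      intro j
      simp only [optionPayoff, Sum.elim_inl, h4 j]
      ring
    simp only [terminalValue, s, h9, h10, Finset.sum_add_distrib]
    rw [Fintype.sum_sum_type, Fintype.sum_prod_type] at h8
    linarith
  obtain ⟨ω, h1, h2⟩ := (hval.and (hNA s (hval.mono fun ω h => hr0.le.trans h))).exists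
  linarith

/-- The functional behind the pricing measure: nonpositive on the gains, strictly positive almost
surely, and uniformly negative on the normalised positions in `g` and `h`. It is the sum of a vector
separating the positions and a small multiple of a strictly positive one. -/
theorem exists_separating_functional [IsProbabilityMeasure P] [IsSeparable P]
    (hX : X.StrictNoArbitrage P) :
    ∃ z : Lp ℝ 2 P, (∀ Y ∈ weightedClaims P X.gains X.weight, inner ℝ z Y ≤ 0) ∧
      (∀ᵐ ω ∂P, 0 < z ω) ∧ ∃ δ : ℝ, 0 < δ ∧ ∀ x ∈ positions ℱ P M N,
        inner ℝ z (positionPayoff X.memLp_weight_mul_optionPayoff x) ≤ -δ := by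
  obtain ⟨_, _, _, _, hNA⟩ := id hX
  have hgains := X.eq_zero_of_mem_gains hNA
  have hK := X.isStableClosed_gains hgains
  set Γ := positionPayoff (P := P) X.memLp_weight_mul_optionPayoff
  obtain ⟨z₁, hz₁, hpos⟩ := exists_polar_pos hK hgains X.weight_pos
  obtain ⟨z₀, δ, hδ, hz₀, hsep⟩ := exists_polar_inner_le_neg
    (isClosed_weightedClaims hK X.weight_pos) convex_weightedClaims zero_mem_weightedClaims
    (fun Y hY t ht => smul_mem_weightedClaims hY ht) (isClosed_positions (ℱ := ℱ) (P := P))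
    convex_positions (fun x hx => norm_le_of_mem_positions hx) Γ
    fun x hx => X.neg_positionPayoff_notMem hX hx
  set R : ℝ := √(Fintype.card (Fin M ⊕ (Fin N × Fin (T + 1))))
  set B : ℝ := ‖z₁‖ * (‖Γ‖ * R) + 1 with hB
  have hB0 : 0 < B := by positivity
  have hbound : ∀ x ∈ positions ℱ P M N, inner ℝ z₁ (Γ x) ≤ B := fun x hx => by
    have h1 : ‖Γ x‖ ≤ ‖Γ‖ * R := (Γ.le_opNorm x).trans
      (mul_le_mul_of_nonneg_left (norm_le_of_mem_positions hx) (norm_nonneg _))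
    have h2 := (real_inner_le_norm z₁ (Γ x)).trans
      (mul_le_mul_of_nonneg_left h1 (norm_nonneg z₁))
    linarith
  -- The multiple of `z₁` is so small that it uses up at most half of the separation `δ`.
  have hε : 0 < δ / (2 * B) := by positivity
  refine ⟨z₀ + (δ / (2 * B)) • z₁, fun Y hY => ?_, ?_, δ / 2, by positivity, fun x hx => ?_⟩
  · rw [inner_add_left, real_inner_smul_left]
    exact add_nonpos (hz₀ Y hY) (mul_nonpos_of_nonneg_of_nonpos hε.le (hz₁ Y hY))
  · filter_upwards [Lp.coeFn_add z₀ ((δ / (2 * B)) • z₁), Lp.coeFn_smul (δ / (2 * B)) z₁, hpos,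
      nonneg_of_mem_polar hz₀] with ω h1 h2 h3 h4
    rw [h1, Pi.add_apply, h2]
    exact add_pos_of_nonneg_of_pos h4 (mul_pos hε h3)
  · rw [inner_add_left, real_inner_smul_left]
    have h1 := mul_le_mul_of_nonneg_left (hbound x hx) hε.le
    have h2 : δ / (2 * B) * B = δ / 2 := by field_simp
    have h3 := hsep x hx
    linarith

end Market

end Separation

/-! ### The pricing measure -/

section PricingMeasure

variable {Ω : Type*} {mΩ : MeasurableSpace Ω} {P Q : Measure Ω} {T d L M N : ℕ}
  {ℱ : Filtration (Fin (T + 1)) mΩ}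

/-- Integration against `Q` is, up to the factor `E`, the pairing with `z w` under `P`: `E` times the
density of `Q` is `z w`, tested on the functions `Y` with `w Y ∈ L²(P)`. -/
def HasDensityProportional (Q P : Measure Ω) (z : Lp ℝ 2 P) (w : Ω → ℝ) (E : ℝ) : Prop :=
  ∀ Y : Ω → ℝ, ∀ hY : MemLp (w * Y) 2 P,
    Integrable Y Q ∧ E * ∫ ω, Y ω ∂Q = inner ℝ z (hY.toLp (w * Y))

theorem exists_hasDensityProportional [IsProbabilityMeasure P] {z : Lp ℝ 2 P} {w : Ω → ℝ}
    (hw : Measurable w) (hw0 : ∀ ω, 0 < w ω) (hw1 : ∀ ω, w ω ≤ 1) (hz : ∀ᵐ ω ∂P, 0 < z ω) :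
    ∃ (Q : Measure Ω) (E : ℝ), IsProbabilityMeasure Q ∧ Q ≪ P ∧ P ≪ Q ∧ 0 < E ∧
      HasDensityProportional Q P z w E := by
  have hzm : Measurable z := (Lp.stronglyMeasurable z).measurable
  have hzw : ∀ᵐ ω ∂P, 0 < z ω * w ω := hz.mono fun ω h => mul_pos h (hw0 ω)
  have hint : Integrable (fun ω => z ω * w ω) P := by
    refine ((Lp.memLp z).integrable (by norm_num)).mul_bdd (c := 1) hw.aestronglyMeasurable
      (ae_of_all _ fun ω => ?_)
    rw [Real.norm_of_nonneg (hw0 ω).le]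
    exact hw1 ω
  set E : ℝ := ∫ ω, z ω * w ω ∂P with hE
  have hE0 : 0 < E := by
    rw [hE, integral_pos_iff_support_of_nonneg_ae (hzw.mono fun ω h => h.le) hint]
    have : Function.support (fun ω => z ω * w ω) =ᵐ[P] Set.univ := by
      filter_upwards [hzw] with ω hω
      exact propext ⟨fun _ => trivial, fun _ => hω.ne'⟩
    rw [measure_congr this, measure_univ]
    exact one_pos
  set D : Ω → ℝ := fun ω => z ω * w ω / E with hD
  have hDm : Measurable D := (hzm.mul hw).div_const E
  have hD0 : ∀ᵐ ω ∂P, 0 < D ω := hzw.mono fun ω h => div_pos h hE0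
  have hDi : Integrable D P := hint.div_const E
  refine ⟨P.withDensity fun ω => ENNReal.ofReal (D ω), E, ⟨?_⟩,
    withDensity_absolutelyContinuous _ _,
    withDensity_absolutelyContinuous' hDm.ennreal_ofReal.aemeasurable ?_, hE0, fun Y hY => ?_⟩
  · rw [withDensity_apply _ MeasurableSet.univ, Measure.restrict_univ,
      ← ofReal_integral_eq_lintegral_ofReal hDi (hD0.mono fun ω h => h.le)]
    simp only [hD]
    rw [integral_div, ← hE, div_self hE0.ne', ENNReal.ofReal_one]
  · filter_upwards [hD0] with ω hω
    exact (ENNReal.ofReal_pos.2 hω).ne'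
  · have heq : ∀ᵐ ω ∂P, (ENNReal.ofReal (D ω)).toReal • Y ω =
        E⁻¹ * inner ℝ (z ω) (hY.toLp (w * Y) ω) := by
      filter_upwards [hD0, hY.coeFn_toLp] with ω h1 h2
      rw [ENNReal.toReal_ofReal h1.le, h2]
      simp only [hD, smul_eq_mul, Pi.mul_apply, Real.inner_apply]
      field_simp
    have hi : Integrable (fun ω => (ENNReal.ofReal (D ω)).toReal • Y ω) P :=
      ((L2.integrable_inner z (hY.toLp (w * Y))).const_mul E⁻¹).congr
        (heq.mono fun ω h => h.symm)
    have hfin : ∀ᵐ ω ∂P, ENNReal.ofReal (D ω) < ∞ := ae_of_all _ fun ω => ENNReal.ofReal_lt_top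
    refine ⟨(integrable_withDensity_iff_integrable_smul' hDm.ennreal_ofReal hfin).2 hi, ?_⟩
    rw [integral_withDensity_eq_integral_toReal_smul hDm.ennreal_ofReal hfin,
      integral_congr_ae heq, integral_const_mul, ← L2.inner_def, mul_inv_cancel_left₀ hE0.ne']

theorem memLp_two_of_weight [IsProbabilityMeasure P] {w Y : Ω → ℝ} (hw : Measurable w)
    (hw0 : ∀ ω, 0 < w ω) (hY : Measurable Y) {C : ℝ} (hC : ∀ ω, w ω * |Y ω| ≤ C) :
    MemLp (w * Y) 2 P :=
  MemLp.of_bound (hw.mul hY).aestronglyMeasurable C (ae_of_all _ fun ω => by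
    rw [Pi.mul_apply, norm_mul, Real.norm_of_nonneg (hw0 ω).le]
    exact hC ω)

namespace Market

variable (X : Market ℱ d L M N)

/-- The indicator of an event known at time `s`, times the change of a stock price after `s`, is an
attainable gain. -/
theorem indicator_stock_sub_mem_gains {s t : Fin (T + 1)} (hst : s ≤ t) {B : Set Ω}
    (hB : MeasurableSet[ℱ s] B) (i : Fin d) :
    (B.indicator fun ω => X.S t ω i - X.S s ω i) ∈ X.gains := by
  induction t using Fin.induction with
  | zero =>
    have : s = 0 := le_antisymm hst (Fin.zero_le s)
    subst this
    simp only [sub_self, Set.indicator_zero]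
    exact Submodule.zero_mem _
  | succ t ih =>
    rcases hst.eq_or_lt with rfl | hlt
    · simp only [sub_self, Set.indicator_zero]
      exact Submodule.zero_mem _
    · have hle : s ≤ t.castSucc := Fin.le_castSucc_iff.2 hlt
      have heq : (B.indicator fun ω => X.S t.succ ω i - X.S s ω i) =
          (B.indicator fun ω => X.S t.castSucc ω i - X.S s ω i) +
            B.indicator 1 * X.stockIncrement t i := by
        funext ω
        by_cases hω : ω ∈ B <;> simp [hω, stockIncrement]
      rw [heq]
      refine Submodule.add_mem _ (ih hle) (X.multiples_stockIncrement_le t i ⟨_, ?_, rfl⟩)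
      exact Measurable.indicator (f := fun _ => (1 : ℝ)) measurable_const (ℱ.mono hle _ hB)

theorem integral_eq_zero_of_mem_gains {z : Lp ℝ 2 P} {E : ℝ} (hE : 0 < E)
    (hQ : HasDensityProportional Q P z X.weight E)
    (hz : ∀ Y ∈ weightedClaims P X.gains X.weight, inner ℝ z Y ≤ 0) {k : Ω → ℝ}
    (hk : k ∈ X.gains) (hk2 : MemLp (X.weight * k) 2 P) : ∫ ω, k ω ∂Q = 0 := by
  have h1 := hz (hk2.toLp _) ⟨k, hk, hk2.coeFn_toLp.le⟩
  have h2 := hz (-hk2.toLp _) ⟨-k, Submodule.neg_mem _ hk, by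
    rw [mul_neg]
    filter_upwards [hk2.coeFn_toLp, Lp.coeFn_neg (hk2.toLp (X.weight * k))] with ω h3 h4
    rw [h4, Pi.neg_apply, h3]
    rfl⟩
  rw [inner_neg_right] at h2
  have h3 := (hQ k hk2).2
  have h4 : E * ∫ ω, k ω ∂Q = 0 := by linarith
  exact (mul_eq_zero.1 h4).resolve_left hE.ne'

theorem martingale_stock [IsProbabilityMeasure P] [IsProbabilityMeasure Q] {z : Lp ℝ 2 P} {E : ℝ}
    (hE : 0 < E) (hQ : HasDensityProportional Q P z X.weight E)
    (hz : ∀ Y ∈ weightedClaims P X.gains X.weight, inner ℝ z Y ≤ 0) : Martingale X.S ℱ Q := by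
  have hcoord : ∀ t i, Measurable fun ω => X.S t ω i := fun t i =>
    (EuclideanSpace.proj (𝕜 := ℝ) i).continuous.measurable.comp (X.measurable_stock t)
  have hcoord_le : ∀ t i ω, X.weight ω * |X.S t ω i| ≤ 1 := fun t i ω =>
    (mul_le_mul_of_nonneg_left (PiLp.norm_apply_le (X.S t ω) i) (X.weight_pos ω).le).trans
      (X.weight_mul_norm_stock_le t ω)
  have hint : ∀ t, Integrable (X.S t) Q := fun t => by
    refine (integrable_norm_iff (X.measurable_stock t).aestronglyMeasurable).1 (hQ _ ?_).1
    refine memLp_two_of_weight X.measurable_weight X.weight_pos (X.measurable_stock t).norm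
      (C := 1) fun ω => ?_
    rw [abs_of_nonneg (norm_nonneg _)]
    exact X.weight_mul_norm_stock_le t ω
  have hinti : ∀ t i, Integrable (fun ω => X.S t ω i) Q := fun t i => (hQ _
    (memLp_two_of_weight X.measurable_weight X.weight_pos (hcoord t i) (hcoord_le t i))).1
  refine ⟨fun t => (X.adapted_S t).stronglyMeasurable, fun s t hst => ?_⟩
  refine (ae_eq_condExp_of_forall_setIntegral_eq (ℱ.le s) (hint t)
    (fun _ _ _ => (hint s).integrableOn) (fun B hB _ => ?_)
    (X.adapted_S s).stronglyMeasurable.aestronglyMeasurable).symm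
  have hB' := ℱ.le s B hB
  ext i
  have hproj : ∀ u, (∫ ω in B, X.S u ω ∂Q) i = ∫ ω in B, X.S u ω i ∂Q := fun u =>
    ((EuclideanSpace.proj (𝕜 := ℝ) i).integral_comp_comm (hint u).integrableOn).symm
  rw [hproj, hproj]
  have h0 := X.integral_eq_zero_of_mem_gains hE hQ hz
    (X.indicator_stock_sub_mem_gains hst hB i)
    (memLp_two_of_weight X.measurable_weight X.weight_pos
      (((hcoord t i).sub (hcoord s i)).indicator hB') (C := 2) fun ω => by
        have h1 : |B.indicator (fun ω => X.S t ω i - X.S s ω i) ω| ≤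
            |X.S t ω i| + |X.S s ω i| := by
          by_cases hω : ω ∈ B
          · simpa [hω] using abs_sub (X.S t ω i) (X.S s ω i)
          · simp only [hω, not_false_eq_true, Set.indicator_of_notMem, abs_zero]
            positivity
        have h2 := mul_le_mul_of_nonneg_left h1 (X.weight_pos ω).le
        have h3 := hcoord_le t i ω
        have h4 := hcoord_le s i ω
        linarith)
  rw [integral_indicator hB', integral_sub (hinti t i).integrableOn (hinti s i).integrableOn] at h0
  linarith

/-- For a normalised position given by honest functions `Y`, the bound on the separating functional
becomes a bound on the expected payoff under `Q`. -/
theorem integral_optionPayoff_le [IsProbabilityMeasure P] {z : Lp ℝ 2 P} {E δ : ℝ}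
    (hQ : HasDensityProportional Q P z X.weight E)
    (hδ : ∀ x ∈ positions ℱ P M N,
      inner ℝ z (positionPayoff X.memLp_weight_mul_optionPayoff x) ≤ -δ)
    {Y : Fin M ⊕ (Fin N × Fin (T + 1)) → Ω → ℝ} (hY0 : ∀ i ω, 0 ≤ Y i ω) (b : Fin M → ℝ)
    (hYg : ∀ j ω, Y (Sum.inl j) ω = b j) (hYh : ∀ k t, Measurable[ℱ t] (Y (Sum.inr (k, t))))
    (c : Fin N → ℝ) (hYc : ∀ k ω, ∑ t, Y (Sum.inr (k, t)) ω = c k)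
    (hY1 : ∀ ω, ∑ i, Y i ω = 1) :
    E * ∫ ω, ∑ i, X.optionPayoff i ω * Y i ω ∂Q ≤ -δ := by
  have hYm : ∀ i, Measurable (Y i) := by
    rintro (j | ⟨k, t⟩)
    · rw [funext (hYg j)]
      exact measurable_const
    · exact (hYh k t).mono (ℱ.le t) le_rfl
  have hYle : ∀ i ω, Y i ω ≤ 1 := fun i ω => by
    rw [← hY1 ω]
    exact Finset.single_le_sum (f := fun i => Y i ω) (fun j _ => hY0 j ω) (Finset.mem_univ i)
  have hYL : ∀ i, MemLp (Y i) 2 P := fun i => MemLp.of_bound (hYm i).aestronglyMeasurable 1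
    (ae_of_all _ fun ω => by rw [Real.norm_of_nonneg (hY0 i ω)]; exact hYle i ω)
  set x : PiLp 2 fun _ : Fin M ⊕ (Fin N × Fin (T + 1)) => Lp ℝ 2 P :=
    WithLp.toLp 2 fun i => (hYL i).toLp (Y i) with hx
  have hxi : ∀ i, x i = (hYL i).toLp (Y i) := fun i => rfl
  have hcoe : ∀ᵐ ω ∂P, ∀ i, x i ω = Y i ω := ae_all_iff.2 fun i => (hYL i).coeFn_toLp
  have hmem : x ∈ positions ℱ P M N := by
    refine ⟨fun i => ?_, fun j => ?_, fun k t => ?_, fun k => ?_, ?_⟩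
    · rw [← Lp.coeFn_nonneg]
      filter_upwards [hcoe] with ω hω
      rw [hω]
      exact hY0 i ω
    · refine mem_lpMeas_iff_aestronglyMeasurable.2 ⟨fun _ => b j, stronglyMeasurable_const, ?_⟩
      filter_upwards [hcoe] with ω hω
      rw [hω, hYg]
    · refine mem_lpMeas_iff_aestronglyMeasurable.2 ⟨_, (hYh k t).stronglyMeasurable, ?_⟩
      filter_upwards [hcoe] with ω hω
      rw [hω]
    · refine mem_lpMeas_iff_aestronglyMeasurable.2 ⟨fun _ => c k, stronglyMeasurable_const, ?_⟩
      filter_upwards [hcoe, coeFn_finset_sum Finset.univ fun t => x (Sum.inr (k, t))] with ω h1 h2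
      rw [h2, ← hYc k ω]
      exact Finset.sum_congr rfl fun t _ => h1 _
    · refine Lp.ext ?_
      filter_upwards [hcoe, coeFn_finset_sum Finset.univ fun i => x i,
        Lp.coeFn_const 2 P (1 : ℝ)] with ω h1 h2 h3
      rw [h2, h3, Function.const_apply, ← hY1 ω]
      exact Finset.sum_congr rfl fun i _ => h1 i
  have hae : positionPayoff X.memLp_weight_mul_optionPayoff x =ᵐ[P]
      X.weight * fun ω => ∑ i, X.optionPayoff i ω * Y i ω := by
    filter_upwards [hcoe, coeFn_positionPayoff X.memLp_weight_mul_optionPayoff x] with ω h1 h2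
    rw [h2]
    simp only [Pi.mul_apply, Finset.mul_sum, h1, mul_assoc]
  have hL2 : MemLp (X.weight * fun ω => ∑ i, X.optionPayoff i ω * Y i ω) 2 P :=
    (memLp_congr_ae hae).1 (Lp.memLp _)
  rw [(hQ _ hL2).2]
  convert hδ x hmem using 2
  exact Lp.ext (hL2.coeFn_toLp.trans hae.symm)

/-- The expectation bounds are obtained from the position of one European option, and from that of
one American option exercised at a stopping time. -/
theorem nonempty_pricingMeasures [IsProbabilityMeasure P] [IsSeparable P]
    (hX : X.StrictNoArbitrage P) : (X.pricingMeasures P).Nonempty := by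
  obtain ⟨z, hz, hpos, δ, hδ, hsep⟩ := X.exists_separating_functional hX
  obtain ⟨Q, E, hQp, hQP, hPQ, hE, hQ⟩ := exists_hasDensityProportional X.measurable_weight
    X.weight_pos X.weight_le_one hpos
  refine ⟨Q, ⟨hQp, hQP, hPQ, X.martingale_stock hE hQ hz⟩, fun i => ?_, fun j => ?_, fun k => ?_⟩
  · have hfi : Integrable (X.f i) Q := (hQ _ (memLp_two_of_weight X.measurable_weight X.weight_pos
      (X.measurable_option i) (X.weight_mul_abs_option_le i))).1
    refine ⟨hfi, ?_⟩
    have h0 := X.integral_eq_zero_of_mem_gains hE hQ hz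
      (X.multiples_option_le i ⟨1, measurable_const, (one_mul _).symm⟩)
      (memLp_two_of_weight X.measurable_weight X.weight_pos
        ((X.measurable_option i).sub_const (X.fbar i)) (C := 1 + |X.fbar i|) fun ω => by
          have h1 := mul_le_mul_of_nonneg_left (abs_sub (X.f i ω) (X.fbar i)) (X.weight_pos ω).le
          have h2 := X.weight_mul_abs_option_le i ω
          have h3 := mul_le_of_le_one_left (abs_nonneg (X.fbar i)) (X.weight_le_one ω)
          linarith)
    rw [integral_sub hfi (integrable_const _)] at h0
    simp only [integral_const, probReal_univ, one_smul] at h0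
    linarith
  · have h0 := X.integral_optionPayoff_le hQ hsep
      (Y := fun i _ => if i = Sum.inl j then 1 else 0)
      (fun i ω => by split_ifs <;> norm_num) (fun j' => if j' = j then 1 else 0)
      (fun j' ω => by simp) (fun k t => measurable_const) 0 (fun k ω => by simp)
      (fun ω => by simp)
    simp only [mul_ite, mul_one, mul_zero, Finset.sum_ite_eq', Finset.mem_univ, if_true,
      optionPayoff, Sum.elim_inl] at h0
    obtain ⟨C, hC⟩ := X.bounded_g
    have hgi : Integrable (X.g j) Q := Integrable.of_bound
      ((X.measurable_g j).mono (ℱ.le _) le_rfl).aestronglyMeasurable C (ae_of_all _ (hC j))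
    rw [integral_sub hgi (integrable_const _)] at h0
    simp only [integral_const, probReal_univ, one_smul] at h0
    by_contra! hge
    have := mul_nonneg hE.le (sub_nonneg.2 hge)
    linarith
  · obtain ⟨C, hC⟩ := X.bounded_h
    have hne : Nonempty {τ : Ω → Fin (T + 1) //
        IsStoppingTime ℱ (fun ω => ((τ ω : Fin (T + 1)) : WithTop (Fin (T + 1))))} :=
      ⟨⟨fun _ => 0, isStoppingTime_const ℱ 0⟩⟩
    refine lt_of_le_of_lt (ciSup_le fun τ => ?_) (sub_lt_self (X.hbar k) (div_pos hδ hE))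
    obtain ⟨τ, hτ⟩ := τ
    have hset : ∀ t, MeasurableSet[ℱ t] {ω | τ ω = t} := fun t => by
      have := hτ.measurableSet_eq_of_countable t
      simpa only [WithTop.coe_inj] using this
    have h0 := X.integral_optionPayoff_le hQ hsep
      (Y := fun i ω => if i = Sum.inr (k, τ ω) then 1 else 0)
      (fun i ω => by split_ifs <;> norm_num) 0 (fun j ω => by simp)
      (fun k' t => by
        by_cases hk : k' = k
        · subst hk
          simp only [Sum.inr.injEq, Prod.mk.injEq, true_and, eq_comm (a := t)]
          exact Measurable.ite (hset t) measurable_const measurable_const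
        · simp only [Sum.inr.injEq, Prod.mk.injEq, hk, false_and, if_false]
          exact measurable_const)
      (fun k' => if k' = k then 1 else 0)
      (fun k' ω => by
        by_cases hk : k' = k <;> simp [hk])
      (fun ω => by simp)
    simp only [mul_ite, mul_one, mul_zero, Finset.sum_ite_eq', Finset.mem_univ, if_true,
      optionPayoff, Sum.elim_inr] at h0
    have hm : Measurable fun ω => X.h k (τ ω) ω := by
      have heq : (fun ω => X.h k (τ ω) ω) =
          fun ω => ∑ t, {ω | τ ω = t}.indicator (X.h k t) ω := by
        funext ω
        simp [Set.indicator_apply]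
      rw [heq]
      exact Finset.measurable_sum _ fun t _ =>
        ((X.adapted_h k t).mono (ℱ.le t) le_rfl).indicator (ℱ.le t _ (hset t))
    have hhi : Integrable (fun ω => X.h k (τ ω) ω) Q :=
      Integrable.of_bound hm.aestronglyMeasurable C (ae_of_all _ fun ω => hC k (τ ω) ω)
    rw [integral_sub hhi (integrable_const _)] at h0
    simp only [integral_const, probReal_univ, one_smul] at h0
    rw [le_sub_iff_add_le, ← le_sub_iff_add_le', div_le_iff₀ hE]
    linarith

end Market

end PricingMeasure

end SemiStatic

theorem theorem3p1 {Ω : Type*} {mΩ : MeasurableSpace Ω} (P : Measure Ω)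
    [IsProbabilityMeasure P] [MeasureTheory.IsSeparable P] {T d L M N : ℕ}
    (ℱ : Filtration (Fin (T + 1)) mΩ) (X : SemiStatic.Market ℱ d L M N) :
    X.StrictNoArbitrage P ↔ (X.pricingMeasures P).Nonempty :=
  ⟨X.nonempty_pricingMeasures, X.strictNoArbitrage_of_nonempty⟩
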